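/- **Setting.** Let $\overline{\mathbb R}=[-\infty,\infty]$ and let $\mathbb R_{\mathfrak s}=\mathbb R\times\{-,+\}$ be the split real line (points $t-,t+$), with the lexicographic order and its order topology. A *path* $f$ consists of an initial time $\sigma_f$ and a final time $\tau_f$, with $-\infty\le\sigma_f\le\tau_f\le\infty$, and a continuous function $t\star\mapsto f(t\star)\in\overline{\mathbb R}$ on $\{t\star\in\mathbb R_{\mathfrak s}: t\in[\sigma_f,\tau_f]\}$ (a càdlàg function together with its left-continuous modification, where jumps at $\sigma_f$ and $\tau_f$ are allowed and no values are recorded at times $\pm\infty$). Let $\Pi$ be the set of paths, $\Pi^\uparrow=\{f\in\Pi:\tau_f=\infty\}$ and $\Pi^\updownarrow=\{f\in\Pi:\sigma_f=-\infty,\ \tau_f=\infty\}$. Let $\mathbb R^2_{\rm c}=(\overline{\mathbb R}\times\mathbb R)\cup\{(*,-\infty),(*,\infty)\}$ be the compact metrizable space that contains $\overline{\mathbb R}\times\mathbb R$ with its product topology and in which $(x_n,t_n)\to(*,\pm\infty)$ iff $t_n\to\pm\infty$. The *interpolated graph* $H(f)\subseteq\mathbb R^2_{\rm c}$ is the set of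 $(x,t)$ with $t\in[\sigma_f,\tau_f]\cap\mathbb R$ and $x$ in the closed segment between $f(t-)$ and $f(t+)$, together with $(*,-\infty)$ if $\sigma_f=-\infty$ and $(*,\infty)$ if $\tau_f=\infty$. It is totally ordered by time and, at equal times $t$, from $f(t-)$ towards $f(t+)$; write $\sqsubseteq$ for this order and $H^{(2)}(f)=\{(z_1,z_2)\in H(f)^2: z_1\sqsubseteq z_2\}$. The space $\Pi$ carries the M1 topology, given by the Hausdorff distance between the compact sets $H^{(2)}(f)$, and for $S\subseteq\Pi$ the space $\mathcal K(S)$ of nonempty compact subsets of $S$ carries the Hausdorff topology. A path $g$ *extends* $f$ if $H^{(2)}(f)\subseteq H^{(2)}(g)$. Paths $f,g\in\Pi$ are *non-crossing* if there are $f',g'\in\Pi^\updownarrow$ extending $f,g$ respectively such that $f'(t\star)\le g'(t\star)$ for all $t\star\in\mathbb R_{\mathfrak s}$, or $g'(t\star)\le f'(t\star)$ for all $t\star\in\mathbb R_{\mathfrak s}$. A set of paths is non-crossing if all pairs of its elements are. A set $A\subseteq\Pi^\uparrow$ is *pervasive* if for every $z\in\mathbb R^2_{\rm c}$ there is $f\in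 A$ with $z\in H(f)$. A *deterministic weave* is a non-crossing and pervasive $\mathcal A\in\mathcal K(\Pi^\uparrow)$; let $\mathscr W_{\det}\subseteq\mathcal K(\Pi^\uparrow)$ be the set of these. Let $\mathrm{flow}(\mathcal A)$ be the set of all $f\in\Pi^\updownarrow$ such that $f$ and $g$ are non-crossing for every $g\in\mathcal A$. **Statement.** 1. For every deterministic weave $\mathcal A$ we have $\mathrm{flow}(\mathcal A)\in\mathcal K(\Pi^\updownarrow)$, and the map $\mathcal A\mapsto\mathrm{flow}(\mathcal A)$ from $\mathscr W_{\det}$ to $\mathcal K(\Pi^\updownarrow)$ is continuous: if $\mathcal A_n,\mathcal A$ are deterministic weaves with $\mathcal A_n\to\mathcal A$, then $\mathrm{flow}(\mathcal A_n)\to\mathrm{flow}(\mathcal A)$. 2. Let $\mathscr A\subseteq\mathscr W_{\det}$ be relatively compact in $\mathcal K(\Pi^\uparrow)$, and suppose that every limit point of $\mathscr A$ in $\mathcal K(\Pi^\uparrow)$ is non-crossing. Then $\{\mathrm{flow}(\mathcal A):\mathcal A\in\mathscr A\}$ is relatively compact in $\mathcal K(\Pi^\updownarrow)$. -/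

import Mathlib

open Set Filter Topology TopologicalSpace

noncomputable section

namespace Weaves

/-! ### The split real line -/

/-- The split real line: every real `t` is replaced by a pair `t-`, `t+`, encoded as
`(t, false)` and `(t, true)`. -/
def SplitReal : Type := ℝ ×ₗ Bool

namespace SplitReal

/-- The lexicographic order on the split real line. -/
instance : LinearOrder SplitReal := inferInstanceAs (LinearOrder (ℝ ×ₗ Bool))

/-- The split real line carries its order topology. -/
instance : TopologicalSpace SplitReal := Preorder.topology SplitReal

instance : OrderTopology SplitReal := ⟨rfl⟩

/-- The underlying real number of a point of the split real line. -/
def time (p : SplitReal) : ℝ := (ofLex (show ℝ ×ₗ Bool from p)).1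

/-- The point `t-`. -/
def left (t : ℝ) : SplitReal := (toLex (t, false) : ℝ ×ₗ Bool)

/-- The point `t+`. -/
def right (t : ℝ) : SplitReal := (toLex (t, true) : ℝ ×ₗ Bool)

theorem left_or_right (p : SplitReal) : p = left p.time ∨ p = right p.time := by
  obtain ⟨t, b⟩ := p
  cases b
  · exact Or.inl rfl
  · exact Or.inr rfl

@[simp] theorem time_left (t : ℝ) : (left t).time = t := rfl

@[simp] theorem time_right (t : ℝ) : (right t).time = t := rfl

theorem lt_of_time_lt {p q : SplitReal} (h : p.time < q.time) : p < q :=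
  (Prod.Lex.lt_iff (α := ℝ) (β := Bool)).2 (Or.inl h)

theorem time_lt_of_lt_left {p : SplitReal} {t : ℝ} (h : p < left t) : p.time < t := by
  rcases (Prod.Lex.lt_iff (α := ℝ) (β := Bool)).1 h with h | h
  · exact h
  · exact absurd h.2 (by simp [left])

theorem time_lt_of_right_lt {p : SplitReal} {t : ℝ} (h : right t < p) : t < p.time := by
  rcases (Prod.Lex.lt_iff (α := ℝ) (β := Bool)).1 h with h | h
  · exact h
  · exact absurd h.2 (by simp [right])

theorem tendsto_left {α : Type*} {l : Filter α} {P : α → SplitReal} {t : ℝ}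
    (hP : Tendsto (fun a => (P a).time) l (𝓝 t)) (hlt : ∀ᶠ a in l, (P a).time < t) :
    Tendsto P l (𝓝 (left t)) := by
  refine tendsto_order.2 ⟨fun q hq => ?_, fun q hq => ?_⟩
  · filter_upwards [(tendsto_order.1 hP).1 _ (time_lt_of_lt_left hq)] with a ha
    exact lt_of_time_lt ha
  · filter_upwards [hlt] with a ha
    exact (lt_of_time_lt (by simpa using ha)).trans hq

theorem tendsto_right {α : Type*} {l : Filter α} {P : α → SplitReal} {t : ℝ}
    (hP : Tendsto (fun a => (P a).time) l (𝓝 t)) (hlt : ∀ᶠ a in l, t < (P a).time) :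
    Tendsto P l (𝓝 (right t)) := by
  refine tendsto_order.2 ⟨fun q hq => ?_, fun q hq => ?_⟩
  · filter_upwards [hlt] with a ha
    exact hq.trans (lt_of_time_lt (by simpa using ha))
  · filter_upwards [(tendsto_order.1 hP).2 _ (time_lt_of_right_lt hq)] with a ha
    exact lt_of_time_lt ha

end SplitReal

/-! ### Compactified space-time -/

/-- The compactified space-time `(ℝ̄ × ℝ) ∪ {(∗, -∞), (∗, ∞)}`; `point x t` has
spatial coordinate `x` and time coordinate `t`. -/
inductive SpaceTime : Type
  | point (x : EReal) (t : ℝ) : SpaceTime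
  | atBot : SpaceTime
  | atTop : SpaceTime

/-- An increasing homeomorphism of `[-∞, ∞]` onto `[0, 1]` (the logistic function). -/
def squash (x : EReal) : ℝ :=
  (ENNReal.orderIsoUnitIntervalBirational (EReal.expOrderIso x) : ℝ)

theorem squash_injective : Function.Injective squash := fun _ _ h =>
  EReal.expOrderIso.injective (ENNReal.orderIsoUnitIntervalBirational.injective (Subtype.ext h))

theorem continuous_squash : Continuous squash :=
  continuous_subtype_val.comp
    (ENNReal.orderIsoUnitIntervalBirational.continuous.comp EReal.expOrderIso.continuous)

theorem squash_bot : squash ⊥ = 0 := by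
  rw [squash, OrderIso.map_bot, OrderIso.map_bot]; rfl

theorem squash_top : squash ⊤ = 1 := by
  rw [squash, OrderIso.map_top, OrderIso.map_top]; rfl

namespace SpaceTime

/-- The point of space-time with coordinates `(x, t)`, where all the points with
`t = -∞` are identified, and likewise those with `t = ∞`. -/
def mk (x t : EReal) : SpaceTime :=
  if t = ⊥ then atBot else if t = ⊤ then atTop else point x t.toReal

/-- The time coordinate. -/
def time : SpaceTime → EReal
  | point _ t => t
  | atBot => ⊥
  | atTop => ⊤

/-- An injection of space-time into the plane, pinching the vertical strip at `t = ±∞`. -/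
def embed : SpaceTime → ℝ × ℝ
  | point x t => (squash t, squash t * (1 - squash t) * squash x)
  | atBot => (0, 0)
  | atTop => (1, 0)

theorem embed_injective : Function.Injective embed := by
  have h0 : ∀ t : ℝ, squash t ≠ 0 := fun t h =>
    EReal.coe_ne_bot t (squash_injective (h.trans squash_bot.symm))
  have h1 : ∀ t : ℝ, squash t ≠ 1 := fun t h =>
    EReal.coe_ne_top t (squash_injective (h.trans squash_top.symm))
  rintro (⟨x, t⟩ | _ | _) (⟨y, s⟩ | _ | _) h <;> simp only [embed, Prod.mk.injEq] at h
  · obtain ⟨ht, hx⟩ := h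
    have hts : t = s := by exact_mod_cast squash_injective ht
    subst hts
    have hne : squash t * (1 - squash t) ≠ 0 :=
      mul_ne_zero (h0 t) (sub_ne_zero.2 (h1 t).symm)
    rw [squash_injective (mul_left_cancel₀ hne hx)]
  · exact absurd h.1 (h0 t)
  · exact absurd h.1 (h1 t)
  · exact absurd h.1.symm (h0 s)
  · rfl
  · exact absurd h.1 zero_ne_one
  · exact absurd h.1.symm (h1 s)
  · exact absurd h.1 one_ne_zero
  · rfl

/-- The metric pulled back from the plane. It induces the product topology on
`[-∞, ∞] × ℝ`, and `(x_n, t_n)` converges to `(∗, ±∞)` if and only if `t_n → ±∞`. -/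
instance : MetricSpace SpaceTime := MetricSpace.induced embed embed_injective inferInstance

theorem embed_mk (x t : EReal) :
    embed (mk x t) = (squash t, squash t * (1 - squash t) * squash x) := by
  induction t with
  | bot => simp [mk, embed, squash_bot]
  | top => simp [mk, embed, squash_top]
  | coe t => simp [mk, embed]

theorem continuous_mk : Continuous fun p : EReal × EReal => mk p.1 p.2 := by
  refine continuous_induced_rng.2 ?_
  have : (embed ∘ fun p : EReal × EReal => mk p.1 p.2) =
      fun p => (squash p.2, squash p.2 * (1 - squash p.2) * squash p.1) :=
    funext fun p => embed_mk p.1 p.2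
  rw [this]
  have := continuous_squash
  fun_prop

end SpaceTime

/-! ### Paths -/

/-- A càdlàg path `f` on a closed interval `[σ, τ] ⊆ [-∞, ∞]`: a continuous function to
`[-∞, ∞]` on the set of points of the split real line with time in `[σ, τ]`. Values at the
times `±∞` are not recorded. Outside its domain `toFun` is set to `0`, so that two paths
are equal if and only if they have the same domain and the same values on it. -/
structure Path where
  /-- initial time `σ` -/
  start : EReal
  /-- final time `τ` -/
  finish : EReal
  start_le_finish : start ≤ finish
  toFun : SplitReal → EReal
  continuousOn : ContinuousOn toFun {p | (p.time : EReal) ∈ Icc start finish}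
  eq_zero_of_notMem : ∀ p : SplitReal, (p.time : EReal) ∉ Icc start finish → toFun p = 0

namespace Path

/-- `f(t-)` -/
def leftVal (f : Path) (t : ℝ) : EReal := f.toFun (SplitReal.left t)

/-- `f(t+)` -/
def rightVal (f : Path) (t : ℝ) : EReal := f.toFun (SplitReal.right t)

/-- The interpolated graph `H(f)`: the points `(x, t)` with `t ∈ [σ, τ]` and `x` in the
closed segment between `f(t-)` and `f(t+)`, and `(∗, ±∞)` if `±∞ ∈ [σ, τ]`. -/
def graph (f : Path) : Set SpaceTime :=
  {z | match z with
    | .point x t => (t : EReal) ∈ Icc f.start f.finish ∧ x ∈ uIcc (f.leftVal t) (f.rightVal t)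
    | .atBot => f.start = ⊥
    | .atTop => f.finish = ⊤}

/-- The total order on `H(f)`: `(x, s)` comes before `(y, t)` if `s < t`, or if `s = t` and
`x` lies between `f(t-)` and `y`. It is only used for points of `H(f)`. -/
def Before (f : Path) : SpaceTime → SpaceTime → Prop
  | .point x s, .point y t => s < t ∨ s = t ∧ x ∈ uIcc (f.leftVal t) y
  | z, w => z.time ≤ w.time

/-- The second order interpolated graph `H⁽²⁾(f)`. -/
def graph₂ (f : Path) : Set (SpaceTime × SpaceTime) :=
  {z | z.1 ∈ f.graph ∧ z.2 ∈ f.graph ∧ f.Before z.1 z.2}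

theorem mk_mem_graph {f : Path} {x t : EReal} :
    SpaceTime.mk x t ∈ f.graph ↔
      t ∈ Icc f.start f.finish ∧ ∀ r : ℝ, t = r → x ∈ uIcc (f.leftVal r) (f.rightVal r) := by
  induction t with
  | bot => simp [SpaceTime.mk, graph]
  | top => simp [SpaceTime.mk, graph, eq_comm]
  | coe t => simp [SpaceTime.mk, graph]

theorem before_mk {f : Path} {x s y t : EReal} :
    f.Before (SpaceTime.mk x s) (SpaceTime.mk y t) ↔
      s < t ∨ s = t ∧ ∀ r : ℝ, t = r → x ∈ uIcc (f.leftVal r) y := by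
  induction s with
  | bot => induction t <;> simp [SpaceTime.mk, Before, SpaceTime.time]
  | top => induction t <;> simp [SpaceTime.mk, Before, SpaceTime.time]
  | coe s => induction t <;> simp [SpaceTime.mk, Before, SpaceTime.time]

theorem exists_mk_eq (z : SpaceTime) : ∃ p : EReal × EReal, SpaceTime.mk p.1 p.2 = z := by
  rcases z with ⟨x, t⟩ | _ | _
  · exact ⟨(x, t), by simp [SpaceTime.mk]⟩
  · exact ⟨(0, ⊥), by simp [SpaceTime.mk]⟩
  · exact ⟨(0, ⊤), by simp [SpaceTime.mk]⟩

/-- Points of the graph at times strictly on one side of `t` and tending to `t` have spatial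
coordinates tending to the one-sided value at `t`. -/
theorem tendsto_of_mem_graph {f : Path} {α : Type*} {l : Filter α} {X T : α → EReal} {t : ℝ}
    {p : SplitReal} (hp : p.time = t)
    (ht : (t : EReal) ∈ Icc f.start f.finish)
    (hT : Tendsto T l (𝓝 t)) (hmem : ∀ᶠ a in l, SpaceTime.mk (X a) (T a) ∈ f.graph)
    (hside : ∀ P : α → SplitReal, Tendsto (fun a => (P a).time) l (𝓝 t) →
      (∀ᶠ a in l, ((P a).time : EReal) = T a) → Tendsto P l (𝓝 p)) :
    Tendsto X l (𝓝 (f.toFun p)) := by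
  have hT' : Tendsto (fun a => (T a).toReal) l (𝓝 t) := by
    exact (EReal.tendsto_toReal (EReal.coe_ne_top t) (EReal.coe_ne_bot t)).comp hT
  have hreal : ∀ᶠ a in l, ((T a).toReal : EReal) = T a := by
    filter_upwards [hT.eventually_ne (EReal.coe_ne_top t), hT.eventually_ne (EReal.coe_ne_bot t)]
      with a h1 h2
    exact EReal.coe_toReal h1 h2
  have hcont := f.continuousOn p (by simpa [hp] using ht)
  have key : ∀ P : α → SplitReal, (∀ a, (P a).time = (T a).toReal) →
      Tendsto (fun a => f.toFun (P a)) l (𝓝 (f.toFun p)) := by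
    intro P hP
    refine hcont.tendsto.comp (tendsto_nhdsWithin_iff.2 ⟨hside P (by simpa [hP] using hT') ?_, ?_⟩)
    · filter_upwards [hreal] with a ha
      rw [hP, ha]
    · filter_upwards [hreal, hmem] with a ha h
      rw [hP, ha]
      exact (mk_mem_graph.1 h).1
  have hl := key (fun a => SplitReal.left (T a).toReal) fun _ => rfl
  have hr := key (fun a => SplitReal.right (T a).toReal) fun _ => rfl
  have hmin := hl.min hr
  have hmax := hl.max hr
  rw [min_self] at hmin
  rw [max_self] at hmax
  refine tendsto_of_tendsto_of_tendsto_of_le_of_le' hmin hmax ?_ ?_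
  · filter_upwards [hreal, hmem] with a ha h
    exact ((mk_mem_graph.1 h).2 _ ha.symm).1
  · filter_upwards [hreal, hmem] with a ha h
    exact ((mk_mem_graph.1 h).2 _ ha.symm).2

theorem tendsto_leftVal {f : Path} {α : Type*} {l : Filter α} {X T : α → EReal} {t : ℝ}
    (ht : (t : EReal) ∈ Icc f.start f.finish)
    (hT : Tendsto T l (𝓝 t)) (hmem : ∀ᶠ a in l, SpaceTime.mk (X a) (T a) ∈ f.graph)
    (hlt : ∀ᶠ a in l, T a < t) : Tendsto X l (𝓝 (f.leftVal t)) := by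
  refine tendsto_of_mem_graph (SplitReal.time_left t) ht hT hmem fun P hP hPT => ?_
  refine SplitReal.tendsto_left hP ?_
  filter_upwards [hPT, hlt] with a h1 h2
  exact EReal.coe_lt_coe_iff.1 (h1 ▸ h2)

theorem tendsto_rightVal {f : Path} {α : Type*} {l : Filter α} {X T : α → EReal} {t : ℝ}
    (ht : (t : EReal) ∈ Icc f.start f.finish)
    (hT : Tendsto T l (𝓝 t)) (hmem : ∀ᶠ a in l, SpaceTime.mk (X a) (T a) ∈ f.graph)
    (hlt : ∀ᶠ a in l, t < T a) : Tendsto X l (𝓝 (f.rightVal t)) := by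
  refine tendsto_of_mem_graph (SplitReal.time_right t) ht hT hmem fun P hP hPT => ?_
  refine SplitReal.tendsto_right hP ?_
  filter_upwards [hPT, hlt] with a h1 h2
  exact EReal.coe_lt_coe_iff.1 (h1 ▸ h2)

theorem isClosed_uIcc_rel : IsClosed {p : EReal × EReal × EReal | p.1 ∈ uIcc p.2.1 p.2.2} := by
  have : {p : EReal × EReal × EReal | p.1 ∈ uIcc p.2.1 p.2.2} =
      {p | min p.2.1 p.2.2 ≤ p.1} ∩ {p | p.1 ≤ max p.2.1 p.2.2} := rfl
  rw [this]
  exact (isClosed_le (by fun_prop) (by fun_prop)).inter (isClosed_le (by fun_prop) (by fun_prop))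

theorem ultrafilter_cases {α : Type*} (u : Ultrafilter α) (T : α → EReal) (t : EReal) :
    (∀ᶠ a in u, T a < t) ∨ (∀ᶠ a in u, T a = t) ∨ (∀ᶠ a in u, t < T a) := by
  rw [← Ultrafilter.eventually_or, ← Ultrafilter.eventually_or]
  exact Eventually.of_forall fun a => lt_trichotomy _ _

/-- The set of coordinates of points of the second order graph is closed. -/
theorem isClosed_preimage_graph₂ (f : Path) :
    IsClosed {q : (EReal × EReal) × (EReal × EReal) |
      (SpaceTime.mk q.1.1 q.1.2, SpaceTime.mk q.2.1 q.2.2) ∈ f.graph₂} := by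
  refine isClosed_iff_ultrafilter.2 ?_
  rintro ⟨⟨x, s⟩, ⟨y, t⟩⟩ u hu hmem
  set X : (EReal × EReal) × (EReal × EReal) → EReal := fun q => q.1.1
  set S : (EReal × EReal) × (EReal × EReal) → EReal := fun q => q.1.2
  set Y : (EReal × EReal) × (EReal × EReal) → EReal := fun q => q.2.1
  set T : (EReal × EReal) × (EReal × EReal) → EReal := fun q => q.2.2
  have hX : Tendsto X u (𝓝 x) := (continuous_fst.fst.tendsto _).mono_left hu
  have hS : Tendsto S u (𝓝 s) := (continuous_fst.snd.tendsto _).mono_left hu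
  have hY : Tendsto Y u (𝓝 y) := (continuous_snd.fst.tendsto _).mono_left hu
  have hT : Tendsto T u (𝓝 t) := (continuous_snd.snd.tendsto _).mono_left hu
  have h1 : ∀ᶠ q in (u : Filter _), SpaceTime.mk (X q) (S q) ∈ f.graph := by
    filter_upwards [hmem] with q hq using hq.1
  have h2 : ∀ᶠ q in (u : Filter _), SpaceTime.mk (Y q) (T q) ∈ f.graph := by
    filter_upwards [hmem] with q hq using hq.2.1
  have h3 : ∀ᶠ q in (u : Filter _), f.Before (SpaceTime.mk (X q) (S q)) (SpaceTime.mk (Y q) (T q)) := by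
    filter_upwards [hmem] with q hq using hq.2.2
  have graph_closed : ∀ (X S : (EReal × EReal) × (EReal × EReal) → EReal) (x s : EReal),
      Tendsto X u (𝓝 x) → Tendsto S u (𝓝 s) →
      (∀ᶠ q in (u : Filter _), SpaceTime.mk (X q) (S q) ∈ f.graph) →
      SpaceTime.mk x s ∈ f.graph := by
    intro X S x s hX hS h
    have hs : s ∈ Icc f.start f.finish :=
      isClosed_Icc.mem_of_tendsto hS (h.mono fun q hq => (mk_mem_graph.1 hq).1)
    refine mk_mem_graph.2 ⟨hs, fun r hr => ?_⟩
    subst hr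
    rcases ultrafilter_cases u S r with hc | hc | hc
    · rw [tendsto_nhds_unique hX (tendsto_leftVal hs hS h hc)]
      exact left_mem_uIcc
    · refine isClosed_Icc.mem_of_tendsto hX ?_
      filter_upwards [h, hc] with q hq hqc
      exact (mk_mem_graph.1 hq).2 r hqc
    · rw [tendsto_nhds_unique hX (tendsto_rightVal hs hS h hc)]
      exact right_mem_uIcc
  have g1 := graph_closed X S x s hX hS h1
  have g2 := graph_closed Y T y t hY hT h2
  refine ⟨g1, g2, before_mk.2 ?_⟩
  have hle : s ≤ t := le_of_tendsto_of_tendsto hS hT (h3.mono fun q hq => by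
    rcases before_mk.1 hq with h | h
    · exact h.le
    · exact h.1.le)
  rcases hle.lt_or_eq with hlt | heq
  · exact Or.inl hlt
  refine Or.inr ⟨heq, fun r hr => ?_⟩
  subst hr
  subst heq
  have hI := (mk_mem_graph.1 g1).1
  rcases ultrafilter_cases u S r with hc | hc | hc
  · rw [tendsto_nhds_unique hX (tendsto_leftVal hI hS h1 hc)]
    exact left_mem_uIcc
  · rcases ultrafilter_cases u T r with hd | hd | hd
    · obtain ⟨q, hq, hqc, hqd⟩ := (h3.and (hc.and hd)).exists
      rcases before_mk.1 hq with h | h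
      · exact absurd (hqc ▸ h.trans hqd) (lt_irrefl _)
      · exact absurd (h.1 ▸ hqc ▸ hqd) (lt_irrefl _)
    · refine isClosed_uIcc_rel.mem_of_tendsto
        (hX.prodMk_nhds ((tendsto_const_nhds (x := f.leftVal r)).prodMk_nhds hY)) ?_
      filter_upwards [h3, hc, hd] with q hq hqc hqd
      rcases before_mk.1 hq with h | h
      · exact absurd (hqc.trans hqd.symm) h.ne
      · exact h.2 r hqd
    · rw [tendsto_nhds_unique hY (tendsto_rightVal hI hT h2 hd)]
      exact (mk_mem_graph.1 g1).2 r rfl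
  · have hd : ∀ᶠ q in (u : Filter _), (r : EReal) < T q := by
      filter_upwards [h3, hc] with q hq hqc
      rcases before_mk.1 hq with h | h
      · exact hqc.trans h
      · exact h.1 ▸ hqc
    rw [tendsto_nhds_unique hY (tendsto_rightVal hI hT h2 hd)]
    exact (mk_mem_graph.1 g1).2 r rfl

theorem isCompact_graph₂ (f : Path) : IsCompact f.graph₂ := by
  have hc : Continuous fun q : (EReal × EReal) × (EReal × EReal) =>
      (SpaceTime.mk q.1.1 q.1.2, SpaceTime.mk q.2.1 q.2.2) :=
    (SpaceTime.continuous_mk.comp continuous_fst).prodMk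
      (SpaceTime.continuous_mk.comp continuous_snd)
  have := (isClosed_preimage_graph₂ f).isCompact.image hc
  convert this
  ext ⟨z, w⟩
  constructor
  · intro h
    obtain ⟨p, hp⟩ := exists_mk_eq z
    obtain ⟨q, hq⟩ := exists_mk_eq w
    subst hp
    subst hq
    exact ⟨(p, q), h, rfl⟩
  · rintro ⟨q, hq, h⟩
    exact h ▸ hq

theorem nonempty_graph₂ (f : Path) : f.graph₂.Nonempty := by
  have : SpaceTime.mk (f.leftVal f.start.toReal) f.start ∈ f.graph :=
    mk_mem_graph.2 ⟨⟨le_rfl, f.start_le_finish⟩, fun r hr => by simp [hr]⟩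
  exact ⟨(_, _), this, this, before_mk.2 (Or.inr ⟨rfl, fun r hr => by simp [hr]⟩)⟩

/-- The second order interpolated graph, as a nonempty compact set. -/
def compactGraph₂ (f : Path) : NonemptyCompacts (SpaceTime × SpaceTime) :=
  ⟨⟨f.graph₂, f.isCompact_graph₂⟩, f.nonempty_graph₂⟩

theorem graph₂_injective {f g : Path} (h : f.graph₂ = g.graph₂) : f = g := by
  have refl : ∀ (f : Path) (z : SpaceTime), (z, z) ∈ f.graph₂ ↔ z ∈ f.graph := by
    intro f z
    refine ⟨fun h => h.1, fun h => ⟨h, h, ?_⟩⟩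
    obtain ⟨p, rfl⟩ := exists_mk_eq z
    exact before_mk.2 (Or.inr ⟨rfl, fun _ _ => right_mem_uIcc⟩)
  have hgraph : f.graph = g.graph := by
    ext z
    rw [← refl f, ← refl g, h]
  have dom : ∀ (f : Path) (t : EReal), t ∈ Icc f.start f.finish ↔ ∃ x, SpaceTime.mk x t ∈ f.graph := by
    refine fun f t => ⟨fun ht => ⟨f.leftVal t.toReal, mk_mem_graph.2 ⟨ht, ?_⟩⟩,
      fun ⟨x, hx⟩ => (mk_mem_graph.1 hx).1⟩
    rintro r rfl
    simp
  have hdom : Icc f.start f.finish = Icc g.start g.finish := by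
    ext t
    rw [dom, dom, hgraph]
  have hends := (Icc_eq_Icc_iff f.start_le_finish).1 hdom
  have hl : ∀ (f : Path) (t : ℝ), (t : EReal) ∈ Icc f.start f.finish →
      SpaceTime.mk (f.leftVal t) t ∈ f.graph := fun f t ht =>
    mk_mem_graph.2 ⟨ht, fun r hr => by rw [← EReal.coe_eq_coe_iff.1 hr]; exact left_mem_uIcc⟩
  have hr : ∀ (f : Path) (t : ℝ), (t : EReal) ∈ Icc f.start f.finish →
      SpaceTime.mk (f.rightVal t) t ∈ f.graph := fun f t ht =>
    mk_mem_graph.2 ⟨ht, fun r hr => by rw [← EReal.coe_eq_coe_iff.1 hr]; exact right_mem_uIcc⟩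
  have hleft : ∀ t : ℝ, (t : EReal) ∈ Icc f.start f.finish → f.leftVal t = g.leftVal t := by
    intro t ht
    have h1 : (SpaceTime.mk (f.leftVal t) t, SpaceTime.mk (g.leftVal t) t) ∈ f.graph₂ := by
      refine ⟨hl f t ht, hgraph ▸ hl g t (hdom ▸ ht), ?_⟩
      change f.Before (SpaceTime.mk (f.leftVal t) t) (SpaceTime.mk (g.leftVal t) t)
      refine before_mk.2 (Or.inr ⟨rfl, fun r hr => ?_⟩)
      rw [← EReal.coe_eq_coe_iff.1 hr]
      exact left_mem_uIcc
    rw [h] at h1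
    have h3 : g.Before (SpaceTime.mk (f.leftVal t) t) (SpaceTime.mk (g.leftVal t) t) := h1.2.2
    rcases before_mk.1 h3 with h2 | h2
    · exact absurd h2 (lt_irrefl _)
    · simpa using h2.2 t rfl
  have hright : ∀ t : ℝ, (t : EReal) ∈ Icc f.start f.finish → f.rightVal t = g.rightVal t := by
    intro t ht
    have h1 := (mk_mem_graph.1 (hgraph ▸ hr f t ht)).2 t rfl
    have h2 := (mk_mem_graph.1 (hgraph ▸ hr g t (hdom ▸ ht) : _ ∈ f.graph)).2 t rfl
    rw [← hleft t ht, uIcc_comm] at h1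
    rw [uIcc_comm] at h2
    exact eq_of_mem_uIcc_of_mem_uIcc h1 h2
  have hfun : f.toFun = g.toFun := by
    funext p
    by_cases hp : (p.time : EReal) ∈ Icc f.start f.finish
    · rcases p.left_or_right with h | h
      · rw [h]; exact hleft _ hp
      · rw [h]; exact hright _ hp
    · rw [f.eq_zero_of_notMem p hp, g.eq_zero_of_notMem p (hdom ▸ hp)]
  cases f
  cases g
  simp_all

/-- The M1 metric: the Hausdorff distance between second order interpolated graphs. -/
instance : MetricSpace Path :=
  MetricSpace.induced compactGraph₂
    (fun _ _ h => graph₂_injective (congrArg SetLike.coe h)) inferInstance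

/-- Path extension: `g` extends `f`. -/
def ExtendedBy (f g : Path) : Prop := f.graph₂ ⊆ g.graph₂

end Path

/-- The half-infinite paths `Π^↑`. -/
def upPaths : Set Path := {f | f.finish = ⊤}

/-- The bi-infinite paths `Π^↕`. -/
def biPaths : Set Path := {f | f.start = ⊥ ∧ f.finish = ⊤}

/-- Two paths are non-crossing if they have bi-infinite extensions, one of which stays (weakly)
to the left of the other. -/
def NonCrossing (f g : Path) : Prop :=
  ∃ f' ∈ biPaths, ∃ g' ∈ biPaths, f.ExtendedBy f' ∧ g.ExtendedBy g' ∧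
    ((∀ p, f'.toFun p ≤ g'.toFun p) ∨ (∀ p, g'.toFun p ≤ f'.toFun p))

/-- A set of paths is non-crossing if all pairs of its elements are. -/
def IsNonCrossing (A : Set Path) : Prop := ∀ f ∈ A, ∀ g ∈ A, NonCrossing f g

/-- A set of paths is pervasive if through every point of space-time passes one of them. -/
def IsPervasive (A : Set Path) : Prop := ∀ z : SpaceTime, ∃ f ∈ A, z ∈ f.graph

/-- The set `flow(A)` of all bi-infinite paths that do not cross `A`. -/
def flow (A : Set Path) : Set Path := {f ∈ biPaths | ∀ g ∈ A, NonCrossing f g}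

/-- `𝒦(S)`: the nonempty compact subsets of a set `S` of paths, as a subspace of the space
`𝒦(Π)` of nonempty compact sets of paths with the Hausdorff metric. -/
abbrev CompactsIn (S : Set Path) : Type := {A : NonemptyCompacts Path // (A : Set Path) ⊆ S}

/-- The set of deterministic weaves, as a subset of `𝒦(Π^↑)`. -/
def detWeaves : Set (CompactsIn upPaths) :=
  {A | IsNonCrossing (A.1 : Set Path) ∧ IsPervasive (A.1 : Set Path)}

end Weaves

end

noncomputable section

namespace Weaves

/-! The flow has a description that survives limits. A bi-infinite path `f` is flanked by `A` if
through every point strictly on one side of `f` passes a path of `A` that afterwards stays on that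
side. For a weave, the flow is exactly the set of flanked bi-infinite paths. Pervasiveness gives one
inclusion (`flow_dominatedBy`). For the other (`Flanked.mem_flow`), a path of `A` that crosses `f`
would also cross a flanking path; jumps at starting times need a separate limit argument. Reflection
of space (`neg`) halves most proofs.

Limits of flanked paths exist (`exists_limit_flanked`). Second order graphs live in a compact
hyperspace, so they converge along ultrafilters, and the limit is the graph of a path unless at a
single time it goes from `x` to `y` and back. Flanking would turn this into two paths of the limit
weave that jump in opposite directions over a common interval, which non-crossing forbids. Flanking
itself passes to the limit. Hence each flow is compact, and limits of paths of `flow(A_n)` lie in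
`flow(A)`.

Conversely, each `y` in `flow(A)` must be approximated from `flow(A_n)`. Outside countably many
times the paths of a non-crossing set are ordered, and on the remaining dense set of times there is
a smallest function through a given point that is crossed by no path of the weave (`lowerFn`).
Suprema of such functions have one-sided limits, and these form a path of the flow
(`Separating.exists_mem_flow`). Built from finitely many levels below `y`, this path of `flow(A_n)`
obeys any finite set of strict bounds satisfied by `y` once `n` is large, since violations would
produce in the limit a path of `A` that crosses `y`. Refining the bounds forces convergence to `y`.

Finally, pervasiveness passes to limits, so in the second claim the closure consists of weaves, and
its image under the continuous flow map is compact. -/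

theorem mem_uIcc_neg {x a b : EReal} : x ∈ uIcc (-a) (-b) ↔ -x ∈ uIcc a b := by
  simp only [mem_uIcc, EReal.neg_le, EReal.le_neg]
  tauto

namespace Path

/-! ### Points of the interpolated graph -/

/-- The path passes through the point `(x, t)`. -/
def On (f : Path) (x : EReal) (t : ℝ) : Prop := SpaceTime.point x t ∈ f.graph

/-- The path first passes through `(x, s)` and then through `(y, t)`. -/
def Pre (f : Path) (x : EReal) (s : ℝ) (y : EReal) (t : ℝ) : Prop :=
  (SpaceTime.point x s, SpaceTime.point y t) ∈ f.graph₂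

/-- The smallest value at time `t`. -/
def lo (f : Path) (t : ℝ) : EReal := min (f.leftVal t) (f.rightVal t)

/-- The largest value at time `t`. -/
def hi (f : Path) (t : ℝ) : EReal := max (f.leftVal t) (f.rightVal t)

variable {f g h f' g' : Path} {x y a b c : EReal} {s t u : ℝ}

theorem on_iff : f.On x t ↔ (t : EReal) ∈ Icc f.start f.finish ∧
    x ∈ uIcc (f.leftVal t) (f.rightVal t) := Iff.rfl

theorem pre_iff : f.Pre x s y t ↔ f.On x s ∧ f.On y t ∧
    (s < t ∨ s = t ∧ x ∈ uIcc (f.leftVal t) y) := Iff.rfl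

theorem mk_coe (x : EReal) (t : ℝ) : SpaceTime.mk x t = SpaceTime.point x t := by
  simp [SpaceTime.mk]

theorem On.lo_le (h : f.On x t) : f.lo t ≤ x := h.2.1

theorem On.le_hi (h : f.On x t) : x ≤ f.hi t := h.2.2

theorem On.start_le (h : f.On x t) : f.start ≤ t := h.1.1

theorem lo_le_hi (f : Path) (t : ℝ) : f.lo t ≤ f.hi t := min_le_max

theorem hi_lt_iff : f.hi t < c ↔ f.leftVal t < c ∧ f.rightVal t < c := max_lt_iff

theorem mem_Icc_of_up (hf : f ∈ upPaths) (h : f.start ≤ t) :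
    (t : EReal) ∈ Icc f.start f.finish := ⟨h, by rw [show f.finish = ⊤ from hf]; exact le_top⟩

theorem on_of_up (hf : f ∈ upPaths) (h : f.start ≤ t) (hx : x ∈ uIcc (f.leftVal t) (f.rightVal t)) :
    f.On x t := ⟨mem_Icc_of_up hf h, hx⟩

theorem start_le_of_bi (hf : f ∈ biPaths) (t : ℝ) : f.start ≤ t := by rw [hf.1]; exact bot_le

theorem start_lt_of_bi (hf : f ∈ biPaths) (t : ℝ) : f.start < t := by
  rw [hf.1]; exact EReal.bot_lt_coe t

theorem on_lo (hf : f ∈ upPaths) (h : f.start ≤ t) : f.On (f.lo t) t :=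
  on_of_up hf h ⟨le_rfl, min_le_max⟩

theorem on_hi (hf : f ∈ upPaths) (h : f.start ≤ t) : f.On (f.hi t) t :=
  on_of_up hf h ⟨min_le_max, le_rfl⟩

theorem on_leftVal (hf : f ∈ upPaths) (h : f.start ≤ t) : f.On (f.leftVal t) t :=
  on_of_up hf h left_mem_uIcc

theorem on_rightVal (hf : f ∈ upPaths) (h : f.start ≤ t) : f.On (f.rightVal t) t :=
  on_of_up hf h right_mem_uIcc

theorem On.pre_of_lt (h : f.On x s) (h' : f.On y t) (hst : s < t) : f.Pre x s y t :=
  ⟨h, h', Or.inl hst⟩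

theorem On.refl (h : f.On x t) : f.Pre x t x t := ⟨h, h, Or.inr ⟨rfl, right_mem_uIcc⟩⟩

theorem Pre.le (h : f.Pre x s y t) : s ≤ t := by
  rcases h.2.2 with h | h
  · exact h.le
  · exact h.1.le

theorem Pre.mem_uIcc (h : f.Pre x t y t) : x ∈ uIcc (f.leftVal t) y := by
  rcases h.2.2 with h | h
  · exact absurd h (lt_irrefl _)
  · exact h.2

/-- A path that moves upwards at time `t` jumps over the whole of this movement. -/
theorem Pre.jump_up (h : f.Pre x t y t) (hxy : x < y) : f.leftVal t ≤ x ∧ y ≤ f.rightVal t := by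
  have h1 := h.mem_uIcc
  have h2 := h.2.1.2
  rw [Set.mem_uIcc] at h1 h2
  grind

/-- A path that moves downwards at time `t` jumps over the whole of this movement. -/
theorem Pre.jump_down (h : f.Pre x t y t) (hxy : y < x) : x ≤ f.leftVal t ∧ f.rightVal t ≤ y := by
  have h1 := h.mem_uIcc
  have h2 := h.2.1.2
  rw [Set.mem_uIcc] at h1 h2
  grind

/-! ### One-sided limits -/

theorem tendsto_nhdsGT {X : ℝ → EReal} (hf : f ∈ upPaths) (h : f.start ≤ t)
    (hX : ∀ᶠ s in 𝓝[>] t, f.On (X s) s) : Tendsto X (𝓝[>] t) (𝓝 (f.rightVal t)) := by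
  refine tendsto_rightVal (T := fun s : ℝ => (s : EReal)) (mem_Icc_of_up hf h)
    ((continuous_coe_real_ereal.tendsto t).mono_left nhdsWithin_le_nhds) ?_ ?_
  · filter_upwards [hX] with s hs
    rwa [mk_coe]
  · filter_upwards [self_mem_nhdsWithin] with s hs
    exact EReal.coe_lt_coe_iff.2 hs

theorem tendsto_nhdsLT {X : ℝ → EReal} (hf : f ∈ upPaths) (h : f.start ≤ t)
    (hX : ∀ᶠ s in 𝓝[<] t, f.On (X s) s) : Tendsto X (𝓝[<] t) (𝓝 (f.leftVal t)) := by
  refine tendsto_leftVal (T := fun s : ℝ => (s : EReal)) (mem_Icc_of_up hf h)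
    ((continuous_coe_real_ereal.tendsto t).mono_left nhdsWithin_le_nhds) ?_ ?_
  · filter_upwards [hX] with s hs
    rwa [mk_coe]
  · filter_upwards [self_mem_nhdsWithin] with s hs
    exact EReal.coe_lt_coe_iff.2 hs

theorem eventually_start_le_nhdsGT (h : f.start ≤ t) : ∀ᶠ s : ℝ in 𝓝[>] t, f.start ≤ s := by
  filter_upwards [self_mem_nhdsWithin] with s hs
  exact h.trans (EReal.coe_le_coe_iff.2 (le_of_lt hs))

theorem eventually_start_le_nhdsLT (h : f.start < t) : ∀ᶠ s : ℝ in 𝓝[<] t, f.start ≤ s := by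
  have := (continuous_coe_real_ereal.tendsto t).mono_left (nhdsWithin_le_nhds (s := Iio t))
  filter_upwards [this.eventually (lt_mem_nhds h)] with s hs
  exact hs.le

theorem tendsto_lo_nhdsGT (hf : f ∈ upPaths) (h : f.start ≤ t) :
    Tendsto f.lo (𝓝[>] t) (𝓝 (f.rightVal t)) :=
  tendsto_nhdsGT hf h ((eventually_start_le_nhdsGT h).mono fun _ hs => on_lo hf hs)

theorem tendsto_hi_nhdsGT (hf : f ∈ upPaths) (h : f.start ≤ t) :
    Tendsto f.hi (𝓝[>] t) (𝓝 (f.rightVal t)) :=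
  tendsto_nhdsGT hf h ((eventually_start_le_nhdsGT h).mono fun _ hs => on_hi hf hs)

theorem tendsto_lo_nhdsLT (hf : f ∈ upPaths) (h : f.start < t) :
    Tendsto f.lo (𝓝[<] t) (𝓝 (f.leftVal t)) :=
  tendsto_nhdsLT hf h.le ((eventually_start_le_nhdsLT h).mono fun _ hs => on_lo hf hs)

theorem tendsto_hi_nhdsLT (hf : f ∈ upPaths) (h : f.start < t) :
    Tendsto f.hi (𝓝[<] t) (𝓝 (f.leftVal t)) :=
  tendsto_nhdsLT hf h.le ((eventually_start_le_nhdsLT h).mono fun _ hs => on_hi hf hs)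

/-- The one-sided punctured neighbourhoods of the time of a point of the split real line. -/
def side (p : SplitReal) : Filter ℝ :=
  if p = SplitReal.left p.time then 𝓝[<] p.time else 𝓝[>] p.time

theorem side_left (t : ℝ) : side (SplitReal.left t) = 𝓝[<] t := by simp [side]

theorem left_lt_right (t : ℝ) : SplitReal.left t < SplitReal.right t :=
  (Prod.Lex.lt_iff (α := ℝ) (β := Bool)).2
    (Or.inr ⟨rfl, by simp [SplitReal.left, SplitReal.right]⟩)

theorem side_right (t : ℝ) : side (SplitReal.right t) = 𝓝[>] t := by
  simp [side, (left_lt_right t).ne']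

theorem side_cases (p : SplitReal) : side p = 𝓝[<] p.time ∨ side p = 𝓝[>] p.time := by
  unfold side; split_ifs <;> simp

theorem side_le (p : SplitReal) : side p ≤ 𝓝 p.time := by
  rcases side_cases p with h | h <;> rw [h] <;> exact nhdsWithin_le_nhds

instance side_neBot (p : SplitReal) : (side p).NeBot := by
  rcases side_cases p with h | h <;> rw [h] <;> infer_instance

theorem frequently_side_mem {D : Set ℝ} (hD : Dense D) (p : SplitReal) :
    ∃ᶠ s in side p, s ∈ D := by
  rcases side_cases p with h | h <;> rw [h, frequently_iff] <;> intro U hU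
  · obtain ⟨l, hl, hlU⟩ := (mem_nhdsLT_iff_exists_Ioo_subset).1 hU
    obtain ⟨s, hs, hsD⟩ := hD.exists_between hl
    exact ⟨s, hlU hsD, hs⟩
  · obtain ⟨l, hl, hlU⟩ := (mem_nhdsGT_iff_exists_Ioo_subset).1 hU
    obtain ⟨s, hs, hsD⟩ := hD.exists_between hl
    exact ⟨s, hlU hsD, hs⟩

theorem tendsto_lo_side (hf : f ∈ upPaths) {p : SplitReal} (h : f.start < p.time) :
    Tendsto f.lo (side p) (𝓝 (f.toFun p)) := by
  rcases p.left_or_right with hp | hp <;> rw [hp]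
  · rw [side_left]; exact tendsto_lo_nhdsLT hf h
  · rw [side_right]; exact tendsto_lo_nhdsGT hf h.le

theorem tendsto_hi_side (hf : f ∈ upPaths) {p : SplitReal} (h : f.start < p.time) :
    Tendsto f.hi (side p) (𝓝 (f.toFun p)) := by
  rcases p.left_or_right with hp | hp <;> rw [hp]
  · rw [side_left]; exact tendsto_hi_nhdsLT hf h
  · rw [side_right]; exact tendsto_hi_nhdsGT hf h.le

/-! ### Extensions -/

theorem ExtendedBy.on (he : f.ExtendedBy g) (h : f.On x t) : g.On x t := (he h.refl).1

theorem ExtendedBy.pre (he : f.ExtendedBy g) (h : f.Pre x s y t) : g.Pre x s y t := he h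

/-- The right value is a limit over later times, so it is inherited even at the starting time. The
left value at the starting time is not: the extension may enter by a longer jump. Hence the strict
inequality in `ExtendedBy.leftVal_eq`. -/
theorem ExtendedBy.rightVal_eq (he : f.ExtendedBy g) (hf : f ∈ upPaths) (hg : g ∈ biPaths)
    (h : f.start ≤ t) : g.rightVal t = f.rightVal t :=
  tendsto_nhds_unique (tendsto_nhdsGT hg.2 (start_le_of_bi hg t)
    ((eventually_start_le_nhdsGT h).mono fun _ hs => he.on (on_lo hf hs))) (tendsto_lo_nhdsGT hf h)

theorem ExtendedBy.leftVal_eq (he : f.ExtendedBy g) (hf : f ∈ upPaths) (hg : g ∈ biPaths)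
    (h : f.start < t) : g.leftVal t = f.leftVal t :=
  tendsto_nhds_unique (tendsto_nhdsLT hg.2 (start_le_of_bi hg t)
    ((eventually_start_le_nhdsLT h).mono fun _ hs => he.on (on_lo hf hs))) (tendsto_lo_nhdsLT hf h)

theorem ExtendedBy.toFun_eq (he : f.ExtendedBy g) (hf : f ∈ upPaths) (hg : g ∈ biPaths)
    {p : SplitReal} (h : f.start < p.time) : g.toFun p = f.toFun p := by
  rcases p.left_or_right with hp | hp <;> rw [hp]
  · exact he.leftVal_eq hf hg h
  · exact he.rightVal_eq hf hg h.le

theorem ExtendedBy.lo_eq (he : f.ExtendedBy g) (hf : f ∈ upPaths) (hg : g ∈ biPaths)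
    (h : f.start < t) : g.lo t = f.lo t := by
  rw [lo, lo, he.leftVal_eq hf hg h, he.rightVal_eq hf hg h.le]

theorem ExtendedBy.hi_eq (he : f.ExtendedBy g) (hf : f ∈ upPaths) (hg : g ∈ biPaths)
    (h : f.start < t) : g.hi t = f.hi t := by
  rw [hi, hi, he.leftVal_eq hf hg h, he.rightVal_eq hf hg h.le]

theorem pre_left_right (hf : f ∈ upPaths) (h : f.start ≤ t) :
    f.Pre (f.leftVal t) t (f.rightVal t) t :=
  ⟨on_leftVal hf h, on_rightVal hf h, Or.inr ⟨rfl, left_mem_uIcc⟩⟩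

theorem hi_mono (h : ∀ p, f.toFun p ≤ g.toFun p) (t : ℝ) : f.hi t ≤ g.hi t :=
  max_le_max (h _) (h _)

theorem lo_mono (h : ∀ p, f.toFun p ≤ g.toFun p) (t : ℝ) : f.lo t ≤ g.lo t :=
  min_le_min (h _) (h _)

/-! ### Reflection -/

/-- The path reflected in the time axis. -/
def neg (f : Path) : Path where
  start := f.start
  finish := f.finish
  start_le_finish := f.start_le_finish
  toFun p := -f.toFun p
  continuousOn := continuous_neg.comp_continuousOn f.continuousOn
  eq_zero_of_notMem p hp := by rw [f.eq_zero_of_notMem p hp, neg_zero]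

@[simp] theorem neg_start (f : Path) : f.neg.start = f.start := rfl

@[simp] theorem neg_finish (f : Path) : f.neg.finish = f.finish := rfl

@[simp] theorem neg_toFun (f : Path) (p : SplitReal) : f.neg.toFun p = -f.toFun p := rfl

@[simp] theorem neg_leftVal (f : Path) (t : ℝ) : f.neg.leftVal t = -f.leftVal t := rfl

@[simp] theorem neg_rightVal (f : Path) (t : ℝ) : f.neg.rightVal t = -f.rightVal t := rfl

@[simp] theorem neg_neg (f : Path) : f.neg.neg = f := by
  cases f
  simp [neg]

@[simp] theorem neg_lo (f : Path) (t : ℝ) : f.neg.lo t = -f.hi t := by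
  rcases le_total (f.leftVal t) (f.rightVal t) with h | h <;>
    simp [lo, hi, h, EReal.neg_le_neg_iff]

@[simp] theorem neg_hi (f : Path) (t : ℝ) : f.neg.hi t = -f.lo t := by
  rcases le_total (f.leftVal t) (f.rightVal t) with h | h <;>
    simp [lo, hi, h, EReal.neg_le_neg_iff]

theorem neg_on : f.neg.On x t ↔ f.On (-x) t := by
  simp only [on_iff, neg_start, neg_finish, neg_leftVal, neg_rightVal, mem_uIcc_neg]

theorem neg_pre : f.neg.Pre x s y t ↔ f.Pre (-x) s (-y) t := by
  have : x ∈ uIcc (-f.leftVal t) y ↔ -x ∈ uIcc (f.leftVal t) (-y) := by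
    rw [← mem_uIcc_neg, _root_.neg_neg]
  simp only [pre_iff, neg_on, neg_leftVal, this]

theorem ExtendedBy.neg (he : f.ExtendedBy g) : f.neg.ExtendedBy g.neg := by
  have hb : ∀ x s, f.start = ⊥ → f.On x s → g.start = ⊥ := fun x s h hx => by
    have : (SpaceTime.atBot, SpaceTime.atBot) ∈ f.graph₂ := ⟨h, h, le_rfl⟩
    exact (he this).1
  rintro ⟨z, w⟩ hzw
  rcases z with ⟨x, s⟩ | _ | _ <;> rcases w with ⟨y, t⟩ | _ | _
  · exact neg_pre.2 (he.pre (neg_pre.1 hzw))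
  -- Pairs that begin at `(∗, ∞)` and end elsewhere are out of order and disappear here.
  all_goals
    first
    | (have h1 := hzw.2.2; have h2 : (⊤ : EReal) ≤ _ := h1; simp [SpaceTime.time] at h2; done)
    | skip
  · have h1 : _ ≤ (⊥ : EReal) := hzw.2.2
    simp [SpaceTime.time] at h1
  · have := neg_on.1 (show f.neg.On x s from hzw.1)
    have h2 : (SpaceTime.point (-x) s, SpaceTime.atTop) ∈ f.graph₂ := ⟨this, hzw.2.1, le_top⟩
    exact ⟨neg_on.2 (he h2).1, (he h2).2.1, le_top⟩
  · have := neg_on.1 (show f.neg.On y t from hzw.2.1)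
    have h2 : (SpaceTime.atBot, SpaceTime.point (-y) t) ∈ f.graph₂ := ⟨hzw.1, this, bot_le⟩
    exact ⟨(he h2).1, neg_on.2 (he h2).2.1, bot_le⟩
  · exact ⟨(he (show (SpaceTime.atBot, SpaceTime.atBot) ∈ f.graph₂ from
      ⟨hzw.1, hzw.1, le_rfl⟩)).1, (he (show (SpaceTime.atBot, SpaceTime.atBot) ∈ f.graph₂ from
      ⟨hzw.1, hzw.1, le_rfl⟩)).1, le_rfl⟩
  · have h2 : (SpaceTime.atBot, SpaceTime.atTop) ∈ f.graph₂ := ⟨hzw.1, hzw.2.1, le_top⟩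
    exact ⟨(he h2).1, (he h2).2.1, le_top⟩
  · have h2 : (SpaceTime.atTop, SpaceTime.atTop) ∈ f.graph₂ := ⟨hzw.1, hzw.1, le_rfl⟩
    exact ⟨(he h2).1, (he h2).1, le_rfl⟩

theorem neg_mem_bi : f.neg ∈ biPaths ↔ f ∈ biPaths := Iff.rfl

theorem neg_mem_up : f.neg ∈ upPaths ↔ f ∈ upPaths := Iff.rfl

end Path

open Weaves.Path

variable {f g h : Path} {A B : Set Path} {a b c d x y : EReal} {s t u : ℝ}

/-! ### Non-crossing and reflection -/

theorem NonCrossing.neg (h : NonCrossing f g) : NonCrossing f.neg g.neg := by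
  obtain ⟨f', hf', g', hg', hff, hgg, hle⟩ := h
  refine ⟨f'.neg, hf', g'.neg, hg', hff.neg, hgg.neg, ?_⟩
  simp only [neg_toFun, EReal.neg_le_neg_iff]
  exact hle.symm

/-- A set of paths reflected in the time axis. -/
def negSet (A : Set Path) : Set Path := {f | f.neg ∈ A}

theorem neg_mem_negSet : f.neg ∈ negSet A ↔ f ∈ A := by simp [negSet]

@[simp] theorem negSet_negSet (A : Set Path) : negSet (negSet A) = A := by
  ext f; simp [negSet]

theorem negSet_subset_up (hA : A ⊆ upPaths) : negSet A ⊆ upPaths :=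
  fun _ hf => neg_mem_up.1 (hA hf)

theorem IsNonCrossing.negSet (hA : IsNonCrossing A) : IsNonCrossing (negSet A) := by
  intro f hf g hg
  simpa using (hA _ hf _ hg).neg

/-- Two paths of a non-crossing set cannot move in opposite directions over a common interval
in such a way that the lower starting point belongs to the path that moves upwards. -/
theorem IsNonCrossing.no_opposite_jumps (hA : IsNonCrossing A) (hg : g ∈ A) (hh : h ∈ A)
    (h1 : g.Pre c t b t) (h2 : h.Pre d t a t) (hcb : c < b) (had : a < d) (hcd : c < d)
    (hab : a < b) : False := by
  obtain ⟨g', hg', h', hh', hgg, hhh, hle⟩ := hA g hg h hh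
  have k1 := (hgg.pre h1).jump_up hcb
  have k2 := (hhh.pre h2).jump_down had
  -- In one order the right values give `b ≤ a`; in the other the left values give `d ≤ c`.
  rcases hle with hle | hle
  · exact absurd ((k1.2.trans (hle _)).trans k2.2) (not_le.2 hab)
  · exact absurd ((k2.1.trans (hle _)).trans k1.1) (not_le.2 hcd)

/-- A bi-infinite path takes the same values as any of its bi-infinite extensions, so only `g` needs
extending. -/
theorem NonCrossing.exists_extension (hf : f ∈ biPaths) (h : NonCrossing f g) :
    ∃ g' ∈ biPaths, g.ExtendedBy g' ∧
      ((∀ p, f.toFun p ≤ g'.toFun p) ∨ ∀ p, g'.toFun p ≤ f.toFun p) := by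
  obtain ⟨f', hf', g', hg', hff, hgg, hle⟩ := h
  refine ⟨g', hg', hgg, ?_⟩
  have : ∀ p, f'.toFun p = f.toFun p := fun p => hff.toFun_eq hf.2 hf' (start_lt_of_bi hf _)
  simpa only [this] using hle

end Weaves

namespace Weaves
open Weaves.Path

variable {f g h : Path} {A B : Set Path} {a b c d x y : EReal} {s t u : ℝ}

/-! ### Limits of paths -/

theorem exists_tendsto_ultrafilter {ι X : Type*} [TopologicalSpace X] [CompactSpace X]
    (𝒱 : Ultrafilter ι) (x : ι → X) : ∃ x₀, Tendsto x 𝒱 (𝓝 x₀) :=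
  ⟨_, (𝒱.map x).le_nhds_lim⟩

/-- All limits along `𝒱` of pairs of consecutive points of `F i` are pairs of consecutive points
of `f`. -/
def SubLimit {ι : Type*} (𝒱 : Filter ι) (F : ι → Path) (f : Path) : Prop :=
  ∀ (x y : ι → EReal) (s u : ι → ℝ) (x₀ y₀ : EReal) (s₀ u₀ : ℝ),
    Tendsto x 𝒱 (𝓝 x₀) → Tendsto s 𝒱 (𝓝 s₀) → Tendsto y 𝒱 (𝓝 y₀) → Tendsto u 𝒱 (𝓝 u₀) →
    (∀ᶠ i in 𝒱, (F i).Pre (x i) (s i) (y i) (u i)) → f.Pre x₀ s₀ y₀ u₀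

theorem SubLimit.on {ι : Type*} {𝒱 : Filter ι} {F : ι → Path} (h : SubLimit 𝒱 F f)
    {x : ι → EReal} {s : ι → ℝ} {x₀ : EReal} {s₀ : ℝ}
    (hx : Tendsto x 𝒱 (𝓝 x₀)) (hs : Tendsto s 𝒱 (𝓝 s₀)) (hon : ∀ᶠ i in 𝒱, (F i).On (x i) (s i)) :
    f.On x₀ s₀ :=
  (h x x s s x₀ x₀ s₀ s₀ hx hs hx hs (hon.mono fun _ hi => hi.refl)).1

theorem SubLimit.neg {ι : Type*} {𝒱 : Filter ι} {F : ι → Path} (h : SubLimit 𝒱 F f) :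
    SubLimit 𝒱 (fun i => (F i).neg) f.neg := by
  intro x y s u x₀ y₀ s₀ u₀ hx hs hy hu hpre
  refine neg_pre.2 (h _ _ s u _ _ s₀ u₀ hx.neg hs hy.neg hu ?_)
  exact hpre.mono fun i hi => neg_pre.1 hi

/-- Families of paths in `B i` have a sublimit in `A` along `𝒱`. -/
def LimitsIn {ι : Type*} (𝒱 : Ultrafilter ι) (B : ι → Set Path) (A : Set Path) : Prop :=
  ∀ F : ι → Path, (∀ᶠ i in 𝒱, F i ∈ B i) → ∃ g ∈ A, SubLimit 𝒱 F g

/-- Every ultrafilter family of paths in `A` has a sublimit in `A`. -/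
def LimClosed (A : Set Path) : Prop :=
  ∀ (ι : Type) (𝒱 : Ultrafilter ι), LimitsIn 𝒱 (fun _ => A) A

theorem LimitsIn.negSet {ι : Type*} {𝒱 : Ultrafilter ι} {B : ι → Set Path}
    (h : LimitsIn 𝒱 B A) : LimitsIn 𝒱 (fun i => negSet (B i)) (negSet A) := by
  intro F hF
  obtain ⟨g, hg, hlim⟩ := h (fun i => (F i).neg) hF
  exact ⟨g.neg, neg_mem_negSet.2 hg, by simpa using hlim.neg⟩

theorem LimClosed.negSet (h : LimClosed A) : LimClosed (negSet A) := fun ι 𝒱 => (h ι 𝒱).negSet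

/-- The heights `y i` converge along the ultrafilter by compactness of `[-∞, ∞]`; all that is kept
of their limit is a lower bound. -/
theorem SubLimit.exists_pre_ge {ι : Type*} {𝒱 : Ultrafilter ι} {F : ι → Path}
    (h : SubLimit 𝒱 F f) {x y : ι → EReal} {s u : ι → ℝ} {x₀ y₀ : EReal} {s₀ u₀ : ℝ}
    {b : ι → EReal}
    (hx : Tendsto x 𝒱 (𝓝 x₀)) (hs : Tendsto s 𝒱 (𝓝 s₀)) (hu : Tendsto u 𝒱 (𝓝 u₀))
    (hb : Tendsto b 𝒱 (𝓝 y₀)) (hby : ∀ᶠ i in 𝒱, b i ≤ y i)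
    (hpre : ∀ᶠ i in 𝒱, (F i).Pre (x i) (s i) (y i) (u i)) :
    ∃ y', y₀ ≤ y' ∧ f.Pre x₀ s₀ y' u₀ := by
  obtain ⟨y', hy'⟩ := exists_tendsto_ultrafilter 𝒱 y
  exact ⟨y', le_of_tendsto_of_tendsto hb hy' hby, h x y s u _ _ _ _ hx hs hy' hu hpre⟩

/-! ### Paths flanked by a set of paths -/

/-- Through every point on the right of `f` passes a path of `A` that stays on the right of `f`. -/
def DominatedBy (A : Set Path) (f : Path) : Prop :=
  ∀ s c, f.hi s < c → ∃ g ∈ A, g.On c s ∧ ∀ p : SplitReal, s < p.time → f.toFun p ≤ g.toFun p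

/-- Through every point on one side of `f` passes a path of `A` that stays on this side of `f`. -/
def Flanked (A : Set Path) (f : Path) : Prop := DominatedBy A f ∧ DominatedBy (negSet A) f.neg

theorem Flanked.neg (h : Flanked A f) : Flanked (negSet A) f.neg := by
  refine ⟨h.2, ?_⟩
  simpa using h.1

theorem Flanked.exists_below (h : Flanked A f) (hc : c < f.lo s) :
    ∃ g ∈ A, g.On c s ∧ ∀ p : SplitReal, s < p.time → g.toFun p ≤ f.toFun p := by
  obtain ⟨g, hg, hon, hle⟩ := h.2 s (-c) (by simpa using hc)
  refine ⟨g.neg, hg, neg_on.2 hon, fun p hp => ?_⟩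
  have := hle p hp
  rw [neg_toFun] at this ⊢
  exact EReal.neg_le.1 this

theorem toFun_le_of_frequently {X : ℝ → EReal} {l : EReal} (hg : g ∈ upPaths) {p : SplitReal}
    (hp : g.start < p.time) (hX : Tendsto X (side p) (𝓝 l)) (hle : ∃ᶠ u in side p, X u ≤ g.hi u) :
    l ≤ g.toFun p :=
  le_of_tendsto_of_tendsto_of_frequently hX (tendsto_hi_side hg hp) hle

theorem flow_neg (hf : f ∈ flow A) : f.neg ∈ flow (negSet A) :=
  ⟨hf.1, fun g hg => by simpa using (hf.2 _ hg).neg⟩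

/-- Any path of `A` through `(c, s)` will do: not crossing `f`, and lying to its right at one point,
it has an extension that lies to the right everywhere. -/
theorem flow_dominatedBy (hA : A ⊆ upPaths) (hcov : ∀ x t, ∃ g ∈ A, g.On x t) (hf : f ∈ flow A) :
    DominatedBy A f := by
  intro s c hc
  obtain ⟨g, hg, hon⟩ := hcov c s
  refine ⟨g, hg, hon, fun p hp => ?_⟩
  obtain ⟨g', hg', hext, hle | hle⟩ := (hf.2 g hg).exists_extension hf.1
  · rw [← hext.toFun_eq (hA hg) hg' (hon.start_le.trans_lt (EReal.coe_lt_coe_iff.2 hp))]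
    exact hle p
  · exact absurd ((hext.on hon).le_hi.trans (hi_mono hle s)) (not_le.2 hc)

theorem eventually_start_lt_side (p : SplitReal) (hp : g.start < p.time) :
    ∀ᶠ s : ℝ in side p, g.start < s := by
  have := (continuous_coe_real_ereal.tendsto p.time).mono_left (side_le p)
  exact this.eventually (lt_mem_nhds hp)

theorem eventually_hi_lt_lo (hf : f ∈ upPaths) (hg : g ∈ upPaths) {p : SplitReal}
    (hfp : f.start < p.time) (hp : g.start < p.time) (hlt : f.toFun p < g.toFun p) :
    ∀ᶠ s in side p, f.hi s < g.lo s :=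
  (tendsto_hi_side hf hfp).eventually_lt (tendsto_lo_side hg hp) hlt

/-- A flanking path `h` that starts strictly between `g` and `f` at time `s` stays below `f`, so `g`
would have to cross `h` in order to get above `f` at time `u`. -/
theorem Flanked.no_upcrossing (hA : A ⊆ upPaths) (hnc : IsNonCrossing A)
    (hfl : Flanked A f) (hg : g ∈ A) (hs : g.start < s) (hsu : s < u) (h1 : g.hi s < f.lo s)
    (h2 : f.hi u < g.lo u) : False := by
  obtain ⟨c, hc1, hc2⟩ := exists_between h1
  obtain ⟨h, hh, hon, hle⟩ := hfl.exists_below hc2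
  have hsu' : (s : EReal) < u := EReal.coe_lt_coe_iff.2 hsu
  have hhu : h.lo u ≤ f.hi u := max_le_max (hle (SplitReal.left u) hsu)
    (hle (SplitReal.right u) hsu) |>.trans' (h.lo_le_hi u)
  obtain ⟨h', hh', g', hg', ehh, egg, hle' | hle'⟩ := hnc h hh g hg
  · have := (ehh.on hon).le_hi.trans (hi_mono hle' s)
    rw [egg.hi_eq (hA hg) hg' hs] at this
    exact absurd this (not_le.2 hc1)
  · have := lo_mono hle' u
    rw [egg.lo_eq (hA hg) hg' (hs.trans hsu'),
      ehh.lo_eq (hA hh) hh' (hon.start_le.trans_lt hsu')] at this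
    exact absurd (this.trans hhu) (not_le.2 h2)

/-- Strict inequalities at points of the split line persist at nearby real times on one side. If
both alternatives failed, `g` would lie strictly on opposite sides of `f` at two times, which is an
upcrossing of `f` or, after reflection, of `f.neg`. -/
theorem Flanked.comparable (hA : A ⊆ upPaths) (hnc : IsNonCrossing A) (hf : f ∈ biPaths)
    (hfl : Flanked A f) (hg : g ∈ A) :
    (∀ p : SplitReal, g.start < p.time → f.toFun p ≤ g.toFun p) ∨
      (∀ p : SplitReal, g.start < p.time → g.toFun p ≤ f.toFun p) := by
  by_contra! hcon
  obtain ⟨⟨p, hp, hlt⟩, ⟨q, hq, hlt'⟩⟩ := hcon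
  obtain ⟨s, hs, hss⟩ := ((eventually_hi_lt_lo (hA hg) hf.2 hp (start_lt_of_bi hf _) hlt).and
    (eventually_start_lt_side p hp)).exists
  obtain ⟨u, hu, huu⟩ := ((eventually_hi_lt_lo hf.2 (hA hg) (start_lt_of_bi hf _) hq hlt').and
    (eventually_start_lt_side q hq)).exists
  rcases lt_trichotomy s u with hsu | hsu | hsu
  · exact hfl.no_upcrossing hA hnc hg hss hsu hs hu
  · subst hsu
    exact absurd ((hs.trans_le (f.lo_le_hi s)).trans hu) (not_lt.2 (g.lo_le_hi s))
  · refine Flanked.no_upcrossing (negSet_subset_up hA) hnc.negSet hfl.neg (neg_mem_negSet.2 hg)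
      huu hsu ?_ ?_
    · simpa using hu
    · simpa using hs

/-! ### Extending half-infinite paths -/

theorem extendedBy_of_pre (hg : g ∈ biPaths)
    (h : ∀ x s y t, f.Pre x s y t → g.Pre x s y t) : f.ExtendedBy g := by
  have hon : ∀ x t, f.On x t → g.On x t := fun x t hx => (h _ _ _ _ hx.refl).1
  rintro ⟨z, w⟩ ⟨hz, hw, hzw⟩
  have hgr : ∀ z, z ∈ f.graph → z ∈ g.graph := by
    rintro (⟨x, t⟩ | _ | _) hz
    · exact hon x t hz
    · exact hg.1
    · exact hg.2
  refine ⟨hgr z hz, hgr w hw, ?_⟩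
  rcases z with ⟨x, s⟩ | _ | _ <;> rcases w with ⟨y, t⟩ | _ | _
  · exact (h x s y t ⟨hz, hw, hzw⟩).2.2
  all_goals exact hzw

theorem le_left_iff_lt_right {p : SplitReal} : p ≤ SplitReal.left t ↔ p < SplitReal.right t := by
  refine ⟨fun h => h.trans_lt (left_lt_right t), fun h => not_lt.1 fun h' => ?_⟩
  rcases lt_trichotomy p.time t with hp | hp | hp
  · exact absurd h' (not_lt.2 (SplitReal.lt_of_time_lt hp).le)
  · rcases p.left_or_right with hp' | hp' <;> rw [hp'] at h h' <;> rw [hp] at h h'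
    · exact lt_irrefl _ h'
    · exact lt_irrefl _ h
  · exact absurd h (not_lt.2 (SplitReal.lt_of_time_lt (p := SplitReal.right t) hp).le)

theorem time_le_of_le {p q : SplitReal} (h : p ≤ q) : p.time ≤ q.time :=
  not_lt.1 fun h' => absurd (SplitReal.lt_of_time_lt h') (not_lt.2 h)

theorem continuous_toFun (hf : f ∈ biPaths) : Continuous f.toFun := by
  rw [← continuousOn_univ]
  refine f.continuousOn.mono fun p _ => ?_
  exact mem_Icc_of_up hf.2 (start_le_of_bi hf _)

/-- The path that equals `f ∨ g(σ-)` up to `σ-`, and `g` from `σ+` onwards, where `σ` is the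
starting time of `g`. -/
def glue (f g : Path) (hf : f ∈ biPaths) (hg : g ∈ upPaths) (σ : ℝ) (hσ : g.start = σ) : Path where
  start := ⊥
  finish := ⊤
  start_le_finish := bot_le
  toFun p := if p ≤ SplitReal.left σ then max (f.toFun p) (g.leftVal σ) else g.toFun p
  continuousOn := by
    -- Since `σ-` and `σ+` are adjacent in the split line, both pieces live on open sets and
    -- continuity can be checked on each separately.
    refine Continuous.continuousOn (continuous_iff_continuousAt.2 fun p => ?_)
    by_cases hp : p ≤ SplitReal.left σ
    · have h1 : ContinuousAt (fun p => max (f.toFun p) (g.leftVal σ)) p :=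
        ((continuous_toFun hf).max continuous_const).continuousAt
      refine h1.congr ?_
      filter_upwards [Iio_mem_nhds (le_left_iff_lt_right.1 hp)] with q hq
      rw [if_pos (le_left_iff_lt_right.2 hq)]
    · have hnhds := Ioi_mem_nhds (not_le.1 hp)
      have h1 : ContinuousAt g.toFun p := by
        refine g.continuousOn.continuousAt (mem_of_superset hnhds fun q hq => ?_)
        refine mem_Icc_of_up hg ?_
        rw [hσ]
        exact EReal.coe_le_coe_iff.2 (time_le_of_le (le_of_lt hq))
      refine h1.congr ?_
      filter_upwards [hnhds] with q hq
      rw [if_neg (not_le.2 hq)]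
  eq_zero_of_notMem p hp := absurd ⟨bot_le, le_top⟩ hp

theorem not_right_le_left (h : s ≤ t) : ¬ SplitReal.right t ≤ SplitReal.left s := fun h' => by
  rcases h.lt_or_eq with hlt | rfl
  · exact absurd (SplitReal.lt_of_time_lt (p := .left s) (q := .right t) hlt) (not_lt.2 h')
  · exact absurd (left_lt_right s) (not_lt.2 h')

/-- The extension is free only before the starting time `σ`, where the maximum with `f` keeps it
above `f`. This may raise the value at `σ-`. If `g` does not jump upwards at `σ`, the initial jump
only gets longer; if it does, the lower end of the jump would be cut off, and `h` rules this out. -/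
theorem exists_extension_ge (hf : f ∈ biPaths) (hg : g ∈ upPaths)
    (hle : ∀ p : SplitReal, g.start < p.time → f.toFun p ≤ g.toFun p)
    (h : ∀ σ : ℝ, g.start = σ → g.leftVal σ < g.rightVal σ → f.leftVal σ ≤ g.leftVal σ) :
    ∃ g' ∈ biPaths, g.ExtendedBy g' ∧ ∀ p, f.toFun p ≤ g'.toFun p := by
  rcases eq_or_ne g.start ⊥ with hst | hbot
  · exact ⟨g, ⟨hst, hg⟩, Subset.rfl, fun p => hle p (by rw [hst]; exact EReal.bot_lt_coe _)⟩
  rcases eq_or_ne g.start ⊤ with hst | htop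
  · refine ⟨f, hf, extendedBy_of_pre hf fun x s y t hpre => ?_, fun p => le_rfl⟩
    have := Path.On.start_le hpre.1
    rw [hst] at this
    exact absurd this (not_le.2 (EReal.coe_lt_top s))
  · obtain ⟨σ, hst⟩ : ∃ σ : ℝ, g.start = σ := ⟨_, (EReal.coe_toReal htop hbot).symm⟩
    have hright : f.rightVal σ ≤ g.rightVal σ := by
      refine le_of_tendsto_of_tendsto (tendsto_lo_nhdsGT hf.2 (start_le_of_bi hf σ))
        (tendsto_hi_nhdsGT hg hst.le) ?_
      filter_upwards [self_mem_nhdsWithin] with s hs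
      have hs' : g.start < s := by rw [hst]; exact EReal.coe_lt_coe_iff.2 hs
      exact (f.lo_le_hi s).trans (max_le_max (hle (.left s) hs') (hle (.right s) hs'))
    have hbi : glue f g hf hg σ hst ∈ biPaths := ⟨rfl, rfl⟩
    have hl : (glue f g hf hg σ hst).leftVal σ = max (f.leftVal σ) (g.leftVal σ) := if_pos le_rfl
    have hr : ∀ t, σ ≤ t → (glue f g hf hg σ hst).rightVal t = g.rightVal t := fun t ht =>
      if_neg (not_right_le_left ht)
    have hl' : ∀ t, σ < t → (glue f g hf hg σ hst).leftVal t = g.leftVal t := fun t ht =>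
      if_neg (not_le.2 (SplitReal.lt_of_time_lt (p := .left σ) (q := .left t) ht))
    have hlr := h σ hst
    refine ⟨glue f g hf hg σ hst, hbi, extendedBy_of_pre hbi ?_, fun p => ?_⟩
    · have key : ∀ x t, g.On x t → (glue f g hf hg σ hst).On x t := by
        intro x t hx
        have hσt : σ ≤ t := EReal.coe_le_coe_iff.1 (hst ▸ hx.start_le)
        refine on_of_up hbi.2 bot_le ?_
        have h2 := hx.2
        rw [hr t hσt]
        rcases hσt.lt_or_eq with hlt | rfl
        · rwa [hl' t hlt]
        · rw [hl]
          rw [mem_uIcc] at h2 ⊢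
          grind
      rintro x s y t ⟨h1, h2, h3⟩
      refine ⟨key x s h1, key y t h2, ?_⟩
      rcases h3 with h3 | ⟨h3, h4⟩
      · exact Or.inl h3
      refine Or.inr ⟨h3, ?_⟩
      subst h3
      have hσt : σ ≤ s := EReal.coe_le_coe_iff.1 (hst ▸ Path.On.start_le h1)
      rcases hσt.lt_or_eq with hlt | rfl
      · rwa [hl' s hlt]
      · have h5 := h2.2
        rw [hl]
        rw [mem_uIcc] at h4 h5 ⊢
        grind
    · change f.toFun p ≤ if p ≤ SplitReal.left σ then max (f.toFun p) (g.leftVal σ) else g.toFun p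
      split_ifs with hp
      · exact le_max_left _ _
      · rcases (time_le_of_le (not_le.1 hp).le).lt_or_eq with hlt | heq
        · exact hle p (by rw [hst]; exact EReal.coe_lt_coe_iff.2 hlt)
        · rw [SplitReal.time_left] at heq
          rcases p.left_or_right with h' | h' <;> rw [← heq] at h'
          · exact absurd h'.le hp
          · rw [h']; exact hright

/-! ### Flanked paths belong to the flow -/

/-- If `g(σ-) < c < f(σ-)`, flanking paths through `(c, s)` with `s ↑ σ` stay below `f`, hence end
below `g` at time `u`, and non-crossing with `g` presses them down to `g(σ-)` at `σ-`. Their limit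
jumps down from `c` at time `σ`, while `g` jumps up from below `c` and ends higher: these two paths
cross. -/
theorem Flanked.left_le (hA : A ⊆ upPaths) (hnc : IsNonCrossing A) (hlim : LimClosed A)
    (hf : f ∈ biPaths) (hfl : Flanked A f) (hg : g ∈ A) {σ : ℝ} (hσ : g.start = σ)
    {q : SplitReal} (hq : g.start < q.time) (hfq : f.toFun q < g.toFun q)
    (hjump : g.leftVal σ < g.rightVal σ) : f.leftVal σ ≤ g.leftVal σ := by
  by_contra! hlt
  obtain ⟨c, hc1, hc2⟩ := exists_between hlt
  obtain ⟨u, hu, hσu⟩ := ((eventually_hi_lt_lo hf.2 (hA hg) (start_lt_of_bi hf _) hq hfq).and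
    (eventually_start_lt_side q hq)).exists
  have hσu' : σ < u := EReal.coe_lt_coe_iff.1 (hσ ▸ hσu)
  -- Being below `g` at time `u` decides which extension is the lower one, and the upward jump of
  -- `g` forces its extension to have left value at most `g(σ-)`.
  have hbelow : ∀ h ∈ A, h.start ≤ σ → h.lo u ≤ f.hi u →
      ∃ h' ∈ biPaths, h.ExtendedBy h' ∧ h'.leftVal σ ≤ g.leftVal σ := by
    intro h hh hhs hhu
    obtain ⟨h', hh', g', hg', ehh, egg, hle | hle⟩ := hnc h hh g hg
    · refine ⟨h', hh', ehh, (hle _).trans ?_⟩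
      exact ((egg.pre (pre_left_right (hA hg) hσ.le)).jump_up hjump).1
    · have := lo_mono hle u
      rw [egg.lo_eq (hA hg) hg' hσu,
        ehh.lo_eq (hA hh) hh' (hhs.trans_lt (EReal.coe_lt_coe_iff.2 hσu'))] at this
      exact absurd (this.trans hhu) (not_le.2 hu)
  have hex : ∀ᶠ s in 𝓝[<] σ, ∃ h ∈ A, h.On c s ∧ h.Pre c s (h.leftVal σ) σ ∧
      h.leftVal σ ≤ g.leftVal σ ∧ h.On (h.lo u) u ∧ h.lo u ≤ f.hi u := by
    filter_upwards [(tendsto_lo_nhdsLT hf.2 (start_lt_of_bi hf σ)).eventually (lt_mem_nhds hc2),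
      self_mem_nhdsWithin] with s hs hsσ
    obtain ⟨h, hh, hon, hle⟩ := hfl.exists_below hs
    have hsσ' : s < σ := hsσ
    have hhσ : h.start < σ := hon.start_le.trans_lt (EReal.coe_lt_coe_iff.2 hsσ')
    have hsu : s < u := hsσ'.trans hσu'
    have hhu : h.lo u ≤ f.hi u := (h.lo_le_hi u).trans
      (max_le_max (hle (.left u) hsu) (hle (.right u) hsu))
    obtain ⟨h', hh', ehh, hl⟩ := hbelow h hh hhσ.le hhu
    refine ⟨h, hh, hon, hon.pre_of_lt (on_leftVal (hA hh) hhσ.le) hsσ, ?_,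
      on_lo (hA hh) (hhσ.trans (EReal.coe_lt_coe_iff.2 hσu')).le, hhu⟩
    rwa [← ehh.leftVal_eq (hA hh) hh' hhσ]
  obtain ⟨𝒱, h𝒱⟩ := Ultrafilter.exists_le (𝓝[<] σ)
  have hex' := h𝒱 hex
  have : Nonempty Path := ⟨f⟩
  choose! F hF using fun s => fun h : (∃ h ∈ A, h.On c s ∧ h.Pre c s (h.leftVal σ) σ ∧
      h.leftVal σ ≤ g.leftVal σ ∧ h.On (h.lo u) u ∧ h.lo u ≤ f.hi u) => h
  have hex'' : ∀ᶠ s in (𝒱 : Filter ℝ), _ := Filter.mem_of_superset hex' fun s hs => hF s hs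
  obtain ⟨h, hh, hsub⟩ := hlim ℝ 𝒱 F (hex''.mono fun s hs => hs.1)
  have hid : Tendsto (fun s : ℝ => s) 𝒱 (𝓝 σ) := h𝒱.trans nhdsWithin_le_nhds
  obtain ⟨v, hv⟩ := exists_tendsto_ultrafilter 𝒱 fun s => (F s).lo u
  obtain ⟨α, hα⟩ := exists_tendsto_ultrafilter 𝒱 fun s => (F s).leftVal σ
  have hvle : v ≤ f.hi u := le_of_tendsto hv (hex''.mono fun s hs => hs.2.2.2.2.2)
  have hαle : α ≤ g.leftVal σ := le_of_tendsto hα (hex''.mono fun s hs => hs.2.2.2.1)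
  have honu := hsub.on hv tendsto_const_nhds (hex''.mono fun s hs => hs.2.2.2.2.1)
  have hpre := hsub _ _ _ _ _ _ _ _ tendsto_const_nhds hid hα tendsto_const_nhds
    (hex''.mono fun s hs => hs.2.2.1)
  -- The limit visits `(c, σ)` before `(α, σ)` with `α < c`, so every extension has left value at
  -- least `c` there.
  obtain ⟨h', hh', ehh, hl⟩ := hbelow h hh (Path.On.start_le hpre.1) (honu.lo_le.trans hvle)
  have := ((ehh.pre hpre).jump_down (hαle.trans_lt hc1)).1
  exact absurd (this.trans hl) (not_le.2 hc1)

theorem Flanked.nonCrossing_of_le (hA : A ⊆ upPaths) (hnc : IsNonCrossing A) (hlim : LimClosed A)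
    (hf : f ∈ biPaths) (hfl : Flanked A f) (hg : g ∈ A)
    (hle : ∀ p : SplitReal, g.start < p.time → f.toFun p ≤ g.toFun p)
    {q : SplitReal} (hq : g.start < q.time) (hfq : f.toFun q < g.toFun q) : NonCrossing f g := by
  obtain ⟨g', hg', egg, hle'⟩ := exists_extension_ge hf (hA hg) hle fun σ hσ hjump =>
    hfl.left_le hA hnc hlim hf hg hσ hq hfq hjump
  exact ⟨f, hf, g', hg', Subset.rfl, egg, Or.inl hle'⟩

theorem nonCrossing_of_eq (hf : f ∈ biPaths) (hg : g ∈ upPaths)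
    (hle : ∀ p : SplitReal, g.start < p.time → f.toFun p = g.toFun p)
    (hσ : ∀ σ : ℝ, g.start = σ → g.rightVal σ ≤ g.leftVal σ) : NonCrossing f g := by
  obtain ⟨g', hg', egg, hle'⟩ := exists_extension_ge hf hg (fun p hp => (hle p hp).le)
    fun σ h hjump => absurd hjump (not_lt.2 (hσ σ h))
  exact ⟨f, hf, g', hg', Subset.rfl, egg, Or.inl hle'⟩

theorem Flanked.mem_flow (hA : A ⊆ upPaths) (hnc : IsNonCrossing A) (hlim : LimClosed A)
    (hf : f ∈ biPaths) (hfl : Flanked A f) : f ∈ flow A := by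
  refine ⟨hf, fun g hg => ?_⟩
  -- If `f` and `g` agree after the start of `g`, the extension may be put on either side of `f`;
  -- the direction of the initial jump of `g` decides which side works.
  by_cases heq : ∀ p : SplitReal, g.start < p.time → f.toFun p = g.toFun p
  · by_cases hσ : ∀ σ : ℝ, g.start = σ → g.rightVal σ ≤ g.leftVal σ
    · exact nonCrossing_of_eq hf (hA hg) heq hσ
    · push Not at hσ
      obtain ⟨σ, hσ, hlt⟩ := hσ
      have : NonCrossing f.neg g.neg := by
        refine nonCrossing_of_eq hf (neg_mem_up.2 (hA hg)) (fun p hp => ?_) fun τ hτ => ?_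
        · rw [neg_toFun, neg_toFun, heq p hp]
        · obtain rfl : σ = τ := EReal.coe_eq_coe_iff.1 (hσ.symm.trans hτ)
          simpa using hlt.le
      simpa using this.neg
  · push Not at heq
    obtain ⟨q, hq, hne⟩ := heq
    rcases hfl.comparable hA hnc hf hg with hle | hle
    · exact hfl.nonCrossing_of_le hA hnc hlim hf hg hle hq ((hle q hq).lt_of_ne hne)
    · have : NonCrossing f.neg g.neg := by
        refine hfl.neg.nonCrossing_of_le (negSet_subset_up hA) hnc.negSet hlim.negSet hf
          (neg_mem_negSet.2 hg) (fun p hp => ?_) (q := q) hq ?_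
        · simpa using hle p hp
        · simpa using (hle q hq).lt_of_ne hne.symm
      simpa using this.neg

end Weaves

namespace Weaves
open Weaves.Path

/-! ### Convergence of compact sets along ultrafilters -/

section Compacts
variable {ι X : Type*} [MetricSpace X]

theorem mem_of_tendsto_compacts {𝒱 : Filter ι} [𝒱.NeBot] {K : ι → NonemptyCompacts X}
    {K₀ : NonemptyCompacts X} (hK : Tendsto K 𝒱 (𝓝 K₀)) {z : ι → X} {w : X}
    (hz : Tendsto z 𝒱 (𝓝 w)) (hmem : ∀ᶠ i in 𝒱, z i ∈ K i) : w ∈ K₀ := by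
  have h1 : Tendsto (fun i => dist (z i) w + dist (K i) K₀) 𝒱 (𝓝 0) := by
    simpa using (tendsto_iff_dist_tendsto_zero.1 hz).add (tendsto_iff_dist_tendsto_zero.1 hK)
  have h2 : Metric.infDist w (K₀ : Set X) = 0 := by
    refine le_antisymm (ge_of_tendsto h1 ?_) Metric.infDist_nonneg
    filter_upwards [hmem] with i hi
    rw [dist_comm, Metric.NonemptyCompacts.dist_eq, add_comm]
    refine Metric.infDist_le_infDist_add_dist.trans (add_le_add_left ?_ _)
    exact Metric.infDist_le_hausdorffDist_of_mem hi
      (Metric.hausdorffEDist_ne_top_of_nonempty_of_bounded (K i).nonempty K₀.nonempty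
        (K i).isCompact.isBounded K₀.isCompact.isBounded)
  exact (K₀.isCompact.isClosed.mem_iff_infDist_zero K₀.nonempty).2 h2

theorem exists_tendsto_of_mem_compacts {𝒱 : Filter ι} {K : ι → NonemptyCompacts X}
    {K₀ : NonemptyCompacts X} (hK : Tendsto K 𝒱 (𝓝 K₀)) {w : X} (hw : w ∈ K₀) :
    ∃ z : ι → X, Tendsto z 𝒱 (𝓝 w) ∧ ∀ i, z i ∈ K i := by
  choose z hz hd using fun i => (K i).isCompact.exists_infDist_eq_dist (K i).nonempty w
  refine ⟨z, ?_, hz⟩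
  have h1 : Tendsto (fun i => Metric.infDist w (K i)) 𝒱 (𝓝 (Metric.infDist w K₀)) :=
    ((Metric.lipschitz_infDist_set w).continuous.tendsto K₀).comp hK
  rw [Metric.infDist_zero_of_mem hw] at h1
  rw [tendsto_iff_dist_tendsto_zero]
  exact h1.congr fun i => by rw [hd, dist_comm]

/-- The nearest points in `K₀` converge along the ultrafilter by compactness, and their distance to
`z i` tends to zero. -/
theorem exists_limit_mem_compacts {𝒱 : Ultrafilter ι} {K : ι → NonemptyCompacts X}
    {K₀ : NonemptyCompacts X} (hK : Tendsto K 𝒱 (𝓝 K₀)) {z : ι → X} (hz : ∀ᶠ i in 𝒱, z i ∈ K i) :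
    ∃ w ∈ K₀, Tendsto z 𝒱 (𝓝 w) := by
  choose v hv hd using fun i => K₀.isCompact.exists_infDist_eq_dist K₀.nonempty (z i)
  obtain ⟨w, hw, hlim⟩ := K₀.isCompact.ultrafilter_le_nhds (𝒱.map v)
    (le_principal_iff.2 (Filter.mem_map.2 (Filter.univ_mem' hv)))
  refine ⟨w, hw, ?_⟩
  have h0 : Tendsto (fun i => dist (v i) (z i)) 𝒱 (𝓝 0) := by
    refine squeeze_zero' (Eventually.of_forall fun i => dist_nonneg) ?_
      (tendsto_iff_dist_tendsto_zero.1 hK)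
    filter_upwards [hz] with i hi
    rw [dist_comm, ← hd, Metric.NonemptyCompacts.dist_eq]
    exact Metric.infDist_le_hausdorffDist_of_mem hi
      (Metric.hausdorffEDist_ne_top_of_nonempty_of_bounded (K i).nonempty K₀.nonempty
        (K i).isCompact.isBounded K₀.isCompact.isBounded)
  exact (tendsto_iff_of_dist h0).1 hlim

end Compacts

/-! ### Space-time -/

namespace SpaceTime

theorem surjective_mk : Function.Surjective fun p : EReal × EReal => mk p.1 p.2 :=
  fun z => Path.exists_mk_eq z

instance : CompactSpace SpaceTime :=
  ⟨by rw [← surjective_mk.range_eq]; exact isCompact_range continuous_mk⟩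

theorem time_mk (x t : EReal) : (mk x t).time = t := by
  induction t <;> simp [mk, time]

theorem continuous_time : Continuous time := by
  refine (continuous_mk.isClosedMap.isQuotientMap continuous_mk surjective_mk).continuous_iff.2 ?_
  exact continuous_snd.congr fun p => (time_mk p.1 p.2).symm

theorem tendsto_point {ι : Type*} {𝒱 : Filter ι} {x : ι → EReal} {t : ι → ℝ} {x₀ : EReal} {t₀ : ℝ}
    (hx : Tendsto x 𝒱 (𝓝 x₀)) (ht : Tendsto t 𝒱 (𝓝 t₀)) :
    Tendsto (fun i => point (x i) (t i)) 𝒱 (𝓝 (point x₀ t₀)) := by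
  have := (continuous_mk.tendsto (x₀, (t₀ : EReal))).comp
    (hx.prodMk_nhds ((continuous_coe_real_ereal.tendsto t₀).comp ht))
  simpa only [Function.comp_def, mk_coe] using this

/-- Lift the points to the compact square of coordinates and take a limit there. It lies over `(x₀,
t₀)`, and over a point at a finite time there is only one pair of coordinates. -/
theorem exists_coordinates {ι : Type*} {𝒱 : Ultrafilter ι} {z : ι → SpaceTime} {x₀ : EReal} {t₀ : ℝ}
    (hz : Tendsto z 𝒱 (𝓝 (point x₀ t₀))) :
    ∃ (x : ι → EReal) (t : ι → ℝ), Tendsto x 𝒱 (𝓝 x₀) ∧ Tendsto t 𝒱 (𝓝 t₀) ∧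
      ∀ᶠ i in 𝒱, z i = point (x i) (t i) := by
  choose p hp using fun i => Path.exists_mk_eq (z i)
  obtain ⟨⟨x', t'⟩, hlim⟩ := exists_tendsto_ultrafilter 𝒱 p
  have h1 := (continuous_mk.tendsto (x', t')).comp hlim
  have h2 : mk x' t' = point x₀ t₀ := tendsto_nhds_unique (h1.congr hp) hz
  have ht' : t' = (t₀ : EReal) := by
    rw [← time_mk x' t', h2]; rfl
  subst ht'
  rw [mk_coe] at h2
  obtain rfl : x' = x₀ := by injection h2
  have hxl : Tendsto (fun i => (p i).1) 𝒱 (𝓝 x') := (continuous_fst.tendsto _).comp hlim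
  have htl : Tendsto (fun i => (p i).2) 𝒱 (𝓝 (t₀ : EReal)) := (continuous_snd.tendsto _).comp hlim
  refine ⟨_, fun i => (p i).2.toReal, hxl,
    (EReal.tendsto_toReal (EReal.coe_ne_top t₀) (EReal.coe_ne_bot t₀)).comp htl, ?_⟩
  filter_upwards [htl.eventually_ne (EReal.coe_ne_top t₀),
    htl.eventually_ne (EReal.coe_ne_bot t₀)] with i hi1 hi2
  rw [← mk_coe, EReal.coe_toReal hi1 hi2, hp]

end SpaceTime

variable {f g h : Path} {A : Set Path} {a b c d x y : EReal} {s t u : ℝ}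

theorem isometry_compactGraph₂ : Isometry Path.compactGraph₂ := Isometry.of_dist_eq fun _ _ => rfl

theorem subLimit_of_tendsto {ι : Type*} {𝒱 : Ultrafilter ι} {F : ι → Path}
    (hF : Tendsto F 𝒱 (𝓝 f)) : SubLimit 𝒱 F f := by
  intro x y s u x₀ y₀ s₀ u₀ hx hs hy hu hpre
  exact mem_of_tendsto_compacts ((isometry_compactGraph₂.continuous.tendsto f).comp hF)
    ((SpaceTime.tendsto_point hx hs).prodMk_nhds (SpaceTime.tendsto_point hy hu)) hpre

theorem limitsIn_of_tendsto {ι : Type*} {𝒱 : Ultrafilter ι} {K : ι → NonemptyCompacts Path}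
    {K₀ : NonemptyCompacts Path} (hK : Tendsto K 𝒱 (𝓝 K₀)) :
    LimitsIn 𝒱 (fun i => (K i : Set Path)) K₀ := by
  intro F hF
  obtain ⟨w, hw, hlim⟩ := exists_limit_mem_compacts hK hF
  exact ⟨w, hw, subLimit_of_tendsto hlim⟩

theorem limClosed_compacts (K : NonemptyCompacts Path) : LimClosed (K : Set Path) :=
  fun _ _ => limitsIn_of_tendsto tendsto_const_nhds

/-! ### The intermediate value property of the interpolated graph -/

namespace Path

/-- Take for `r` the first time at which the path, after passing `(x, s)`, reaches a height of at
least `c`. It exists because the second order graph is closed. Minimality gives `f(r-) ≤ c` if `r >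
s`, so the jump at `r` covers `c`. -/
theorem Pre.exists_between_of_le (hf : f ∈ biPaths) (h : f.Pre x s y u) (hxc : x ≤ c)
    (hcy : c ≤ y) : ∃ r, f.Pre x s c r ∧ f.Pre c r y u := by
  set T : Set ℝ := {r | r ∈ Icc s u ∧ ∃ e, c ≤ e ∧ f.Pre x s e r} with hT
  have hclosed : IsClosed T := by
    refine isClosed_iff_ultrafilter.2 fun r 𝒱 h𝒱 hmem => ?_
    refine ⟨isClosed_Icc.mem_of_tendsto (b := (𝒱 : Filter ℝ)) h𝒱
      (mem_of_superset hmem fun r hr => hr.1), ?_⟩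
    choose! e he using fun r (hr : r ∈ T) => hr.2
    obtain ⟨e₀, he₀⟩ := exists_tendsto_ultrafilter 𝒱 e
    refine ⟨e₀, ge_of_tendsto he₀ (mem_of_superset hmem fun r hr => (he r hr).1), ?_⟩
    exact subLimit_of_tendsto (𝒱 := 𝒱) (F := fun _ => f) tendsto_const_nhds _ _ _ _ _ _ _ _
      tendsto_const_nhds tendsto_const_nhds he₀ h𝒱 (mem_of_superset hmem fun r hr => (he r hr).2)
  have hcomp : IsCompact T := isCompact_Icc.of_isClosed_subset hclosed fun r hr => hr.1
  obtain ⟨r, ⟨⟨hsr, hru⟩, e, hce, hpre⟩, hleast⟩ := hcomp.exists_isLeast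
    ⟨u, ⟨h.le, le_rfl⟩, y, hcy, h⟩
  have hx := h.1
  have hy := h.2.1
  have hst : f.start ≤ r := start_le_of_bi hf r
  have hle : s < r → f.leftVal r ≤ c := by
    intro hlt
    refine le_of_tendsto (tendsto_hi_nhdsLT hf.2 (start_lt_of_bi hf r)) ?_
    filter_upwards [Ioo_mem_nhdsLT hlt] with r' hr'
    by_contra! hcon
    refine absurd (hleast ⟨⟨hr'.1.le, hr'.2.le.trans hru⟩, _, hcon.le, ?_⟩) (not_le.2 hr'.2)
    exact On.pre_of_lt hx (on_hi hf.2 (start_le_of_bi hf r')) hr'.1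
  have hxon := hx.2
  have heon := hpre.2.1.2
  have hyon := hy.2
  have hconr : f.On c r := by
    refine on_of_up hf.2 hst ?_
    rcases hsr.lt_or_eq with hlt | rfl
    · have := hle hlt
      rw [Set.mem_uIcc] at heon ⊢
      grind
    · rw [Set.mem_uIcc] at heon hxon ⊢
      grind
  refine ⟨r, ⟨hx, hconr, ?_⟩, ⟨hconr, hy, ?_⟩⟩
  · rcases hsr.lt_or_eq with hlt | rfl
    · exact Or.inl hlt
    · have := hpre.mem_uIcc
      refine Or.inr ⟨rfl, ?_⟩
      rw [Set.mem_uIcc] at this ⊢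
      grind
  · rcases hru.lt_or_eq with hlt | rfl
    · exact Or.inl hlt
    · refine Or.inr ⟨rfl, ?_⟩
      rcases hsr.lt_or_eq with hlt | rfl
      · have := hle hlt
        rw [Set.mem_uIcc]
        grind
      · have := h.mem_uIcc
        rw [Set.mem_uIcc] at this ⊢
        grind

theorem Pre.exists_between (hf : f ∈ biPaths) (h : f.Pre x s y u) (hc : c ∈ uIcc x y) :
    ∃ r, f.Pre x s c r ∧ f.Pre c r y u := by
  rcases Set.mem_uIcc.1 hc with hc | hc
  · exact h.exists_between_of_le hf hc.1 hc.2
  · obtain ⟨r, h1, h2⟩ := Pre.exists_between_of_le (f := f.neg) (x := -x) (y := -y) (c := -c)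
      (s := s) (u := u) (neg_mem_bi.2 hf) (neg_pre.2 (by simpa using h))
      (EReal.neg_le_neg_iff.2 hc.2) (EReal.neg_le_neg_iff.2 hc.1)
    exact ⟨r, by simpa using neg_pre.1 h1, by simpa using neg_pre.1 h2⟩

/-! ### The order on the points of a graph -/

theorem time_le_of_mem_graph₂ {z w : SpaceTime} (h : (z, w) ∈ f.graph₂) : z.time ≤ w.time := by
  have h3 : f.Before z w := h.2.2
  rcases z with ⟨x, s⟩ | _ | _ <;> rcases w with ⟨y, t⟩ | _ | _
  · rcases h3 with h | h
    · exact (EReal.coe_lt_coe_iff.2 h).le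
    · exact (EReal.coe_eq_coe_iff.2 h.1).le
  all_goals exact h3

theorem graph₂_total {z w : SpaceTime} (hz : z ∈ f.graph) (hw : w ∈ f.graph) :
    (z, w) ∈ f.graph₂ ∨ (w, z) ∈ f.graph₂ := by
  suffices f.Before z w ∨ f.Before w z from
    this.imp (fun h => ⟨hz, hw, h⟩) (fun h => ⟨hw, hz, h⟩)
  rcases z with ⟨x, s⟩ | _ | _ <;> rcases w with ⟨y, t⟩ | _ | _
  · rcases lt_trichotomy s t with h | rfl | h
    · exact Or.inl (Or.inl h)
    · have h1 := hz.2
      have h2 := hw.2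
      have : x ∈ uIcc (f.leftVal s) y ∨ y ∈ uIcc (f.leftVal s) x := by
        simp only [Set.mem_uIcc] at h1 h2 ⊢
        grind
      exact this.imp (fun h => Or.inr ⟨rfl, h⟩) (fun h => Or.inr ⟨rfl, h⟩)
    · exact Or.inr (Or.inl h)
  all_goals exact le_total _ _

theorem refl_mem_graph₂ {z : SpaceTime} (hz : z ∈ f.graph) : (z, z) ∈ f.graph₂ :=
  (graph₂_total hz hz).elim id id

end Path

end Weaves

namespace Weaves
open Weaves.Path

variable {f g h : Path} {A B : Set Path} {a b c d x y : EReal} {s t u : ℝ}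

/-! ### Recovering a path from its second order graph -/

section Relation
variable {K : Set (SpaceTime × SpaceTime)}

/-- The relation between points at time `t` given by `K`. -/
def AtTime (K : Set (SpaceTime × SpaceTime)) (t : ℝ) (x y : EReal) : Prop :=
  (SpaceTime.point x t, SpaceTime.point y t) ∈ K

/-- The lowest and highest points at time `t` are comparable under `K`; `l` is the earlier and `r`
the later of the two. Betweenness fills the segment with points and orders it monotonically, and
antisymmetry excludes any other relation. -/
theorem exists_slice (hcl : IsClosed K)
    (hfield : ∀ z w, (z, w) ∈ K → (z, z) ∈ K ∧ (w, w) ∈ K)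
    (htotal : ∀ z w, (z, z) ∈ K → (w, w) ∈ K → (z, w) ∈ K ∨ (w, z) ∈ K)
    (hbetween : ∀ t x y c, AtTime K t x y → c ∈ uIcc x y → AtTime K t x c ∧ AtTime K t c y)
    (hne : ∀ t, ∃ x, AtTime K t x x)
    (hanti : ∀ t x y, AtTime K t x y → AtTime K t y x → x = y) (t : ℝ) :
    ∃ l r, (∀ x, AtTime K t x x ↔ x ∈ uIcc l r) ∧
      ∀ x y, x ∈ uIcc l r → y ∈ uIcc l r → (AtTime K t x y ↔ x ∈ uIcc l y) := by
  set H : Set EReal := {x | AtTime K t x x} with hH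
  have hcont : Continuous fun x : EReal => SpaceTime.point x t := by
    have := SpaceTime.continuous_mk.comp (Continuous.prodMk_left (X := EReal) (t : EReal))
    simpa only [Function.comp_def, mk_coe] using this
  have hHcl : IsClosed H := hcl.preimage (hcont.prodMk hcont)
  obtain ⟨a, ha, ha'⟩ := hHcl.isCompact.exists_isLeast (hne t)
  obtain ⟨b, hb, hb'⟩ := hHcl.isCompact.exists_isGreatest (hne t)
  obtain ⟨l, r, hlr, hsub⟩ : ∃ l r, AtTime K t l r ∧ H ⊆ uIcc l r := by
    rcases htotal _ _ ha hb with hab | hab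
    · exact ⟨a, b, hab, fun x hx => mem_uIcc.2 (Or.inl ⟨ha' hx, hb' hx⟩)⟩
    · exact ⟨b, a, hab, fun x hx => mem_uIcc.2 (Or.inr ⟨ha' hx, hb' hx⟩)⟩
  have hmem : ∀ x, x ∈ uIcc l r → AtTime K t x x := fun x hx =>
    (hfield _ _ (hbetween t l r x hlr hx).1).2
  refine ⟨l, r, fun x => ⟨fun hx => hsub hx, hmem x⟩, fun x y hx hy => ⟨fun hxy => ?_, fun hxy => ?_⟩⟩
  · by_contra hcon
    have hyx : y ∈ uIcc l x := by
      rw [mem_uIcc] at hx hy hcon ⊢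
      grind
    have := (hbetween t l x y (hbetween t l r x hlr hx).1 hyx).2
    obtain rfl := hanti t x y hxy this
    exact hcon right_mem_uIcc
  · exact (hbetween t l y x (hbetween t l r y hlr hy).1 hxy).2

theorem tendsto_time_nhdsLE {p : SplitReal} {𝒱 : Ultrafilter SplitReal} (h𝒱 : ↑𝒱 ≤ 𝓝 p) :
    Tendsto SplitReal.time 𝒱 (𝓝 p.time) := by
  refine tendsto_order.2 ⟨fun a ha => ?_, fun a ha => ?_⟩
  · obtain ⟨b, hab, hbp⟩ := exists_between ha
    filter_upwards [h𝒱 (Ioi_mem_nhds (SplitReal.lt_of_time_lt (p := .left b) hbp))] with q hq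
    exact hab.trans_le (time_le_of_le (le_of_lt hq))
  · obtain ⟨b, hpb, hba⟩ := exists_between ha
    filter_upwards [h𝒱 (Iio_mem_nhds (SplitReal.lt_of_time_lt (q := .left b) hpb))] with q hq
    exact (time_le_of_le (le_of_lt hq)).trans_lt hba

/-- The values at `t-` and `t+` are the first and last points of `K` at time `t`. A limit of values
at times before `t` lies in the slice at `t` and, as `K` is closed, precedes its first point, hence
equals it; likewise from the right. This is continuity on the split line. -/
theorem exists_path_of_relation (hcl : IsClosed K)
    (hfield : ∀ z w, (z, w) ∈ K → (z, z) ∈ K ∧ (w, w) ∈ K)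
    (htotal : ∀ z w, (z, z) ∈ K → (w, w) ∈ K → (z, w) ∈ K ∨ (w, z) ∈ K)
    (htime : ∀ z w, (z, w) ∈ K → z.time ≤ w.time)
    (hbetween : ∀ t x y c, AtTime K t x y → c ∈ uIcc x y → AtTime K t x c ∧ AtTime K t c y)
    (hne : ∀ t, ∃ x, AtTime K t x x)
    (hbot : (SpaceTime.atBot, SpaceTime.atBot) ∈ K) (htop : (SpaceTime.atTop, SpaceTime.atTop) ∈ K)
    (hanti : ∀ t x y, AtTime K t x y → AtTime K t y x → x = y) :
    ∃ f ∈ biPaths, f.graph₂ = K := by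
  choose l r hH hord using exists_slice hcl hfield htotal hbetween hne hanti
  have hlt : ∀ z w, (z, z) ∈ K → (w, w) ∈ K → z.time < w.time → (z, w) ∈ K := by
    intro z w hz hw hzw
    exact (htotal z w hz hw).resolve_right fun h => absurd (htime _ _ h) (not_le.2 hzw)
  set F : SplitReal → EReal := fun p => if p = SplitReal.left p.time then l p.time else r p.time
    with hF
  have hFl : ∀ t, F (SplitReal.left t) = l t := fun t => by simp [hF]
  have hFr : ∀ t, F (SplitReal.right t) = r t := fun t => by simp [hF, (left_lt_right t).ne']
  have hFmem : ∀ p, AtTime K p.time (F p) (F p) := by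
    intro p
    rw [hH]
    rcases p.left_or_right with h | h <;> rw [h]
    · rw [hFl]; exact left_mem_uIcc
    · rw [hFr]; exact right_mem_uIcc
  have hcont : Continuous F := by
    refine continuous_iff_ultrafilter.2 fun p 𝒱 h𝒱 => ?_
    obtain ⟨y, hy⟩ := exists_tendsto_ultrafilter 𝒱 F
    have hT := tendsto_time_nhdsLE h𝒱
    have hpt := SpaceTime.tendsto_point hy hT
    have hyy : AtTime K p.time y y :=
      hcl.mem_of_tendsto (hpt.prodMk_nhds hpt) (Eventually.of_forall hFmem)
    have hcase : (∀ᶠ q in (𝒱 : Filter SplitReal), q = p) ∨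
        (∀ᶠ q in (𝒱 : Filter SplitReal), q < p) ∨ (∀ᶠ q in (𝒱 : Filter SplitReal), p < q) := by
      rw [← Ultrafilter.eventually_or, ← Ultrafilter.eventually_or]
      exact Eventually.of_forall fun q => by
        rcases lt_trichotomy q p with h | h | h <;> simp [h]
    rcases hcase with hc | hc
    · exact tendsto_const_nhds.congr' (hc.mono fun q hq => by simp only [hq])
    suffices y = F p from this ▸ hy
    rcases p.left_or_right with hp | hp
    · have hev : ∀ᶠ q in (𝒱 : Filter SplitReal), q.time < p.time := by
        rcases hc with hc | hc
        · filter_upwards [hc] with q hq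
          rw [hp] at hq
          exact SplitReal.time_lt_of_lt_left hq
        · have h1 : ∀ᶠ q in (𝒱 : Filter SplitReal), q < SplitReal.right p.time :=
            h𝒱 (Iio_mem_nhds (by nth_rw 1 [hp]; exact left_lt_right _))
          obtain ⟨q, hq1, hq2⟩ := (hc.and h1).exists
          exact absurd (le_left_iff_lt_right.2 hq2) (not_le.2 (by rw [← hp]; exact hq1))
      have hm : AtTime K p.time y (F p) := by
        refine hcl.mem_of_tendsto (hpt.prodMk_nhds tendsto_const_nhds) ?_
        filter_upwards [hev] with q hq
        exact hlt _ _ (hFmem q) (hFmem p) (EReal.coe_lt_coe_iff.2 hq)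
      have h2 := (hord p.time y (F p) ((hH _ _).1 hyy) ((hH _ _).1 (hFmem p))).1 hm
      have hFp : F p = l p.time := by rw [hp, hFl]; rfl
      rw [hFp] at h2 ⊢
      simpa using h2
    · have hev : ∀ᶠ q in (𝒱 : Filter SplitReal), p.time < q.time := by
        rcases hc with hc | hc
        · have h1 : ∀ᶠ q in (𝒱 : Filter SplitReal), SplitReal.left p.time < q :=
            h𝒱 (Ioi_mem_nhds (by nth_rw 2 [hp]; exact left_lt_right _))
          obtain ⟨q, hq1, hq2⟩ := (hc.and h1).exists
          rw [hp] at hq1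
          exact absurd (le_left_iff_lt_right.2 hq1) (not_le.2 hq2)
        · filter_upwards [hc] with q hq
          rw [hp] at hq
          exact SplitReal.time_lt_of_right_lt hq
      have hm : AtTime K p.time (F p) y := by
        refine hcl.mem_of_tendsto (tendsto_const_nhds.prodMk_nhds hpt) ?_
        filter_upwards [hev] with q hq
        exact hlt _ _ (hFmem p) (hFmem q) (EReal.coe_lt_coe_iff.2 hq)
      have hyH := (hH _ _).1 hyy
      have h2 := (hord p.time (F p) y ((hH _ _).1 (hFmem p)) hyH).1 hm
      have hFp : F p = r p.time := by rw [hp, hFr]; rfl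
      rw [hFp] at h2 ⊢
      rw [mem_uIcc] at h2 hyH
      grind
  let f : Path :=
    { start := ⊥
      finish := ⊤
      start_le_finish := bot_le
      toFun := F
      continuousOn := hcont.continuousOn
      eq_zero_of_notMem := fun p hp => absurd ⟨bot_le, le_top⟩ hp }
  have hbi : f ∈ biPaths := ⟨rfl, rfl⟩
  have hfl : ∀ t, f.leftVal t = l t := hFl
  have hfr : ∀ t, f.rightVal t = r t := hFr
  have hgraph : ∀ z, z ∈ f.graph ↔ (z, z) ∈ K := by
    rintro (⟨x, t⟩ | _ | _)
    · change _ ↔ AtTime K t x x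
      rw [hH, ← hfl, ← hfr]
      exact ⟨fun h => h.2, fun h => on_of_up hbi.2 bot_le h⟩
    · exact ⟨fun _ => hbot, fun _ => rfl⟩
    · exact ⟨fun _ => htop, fun _ => rfl⟩
  refine ⟨f, hbi, ?_⟩
  have hsame : ∀ t x y, (x ∈ uIcc (l t) (r t)) → (y ∈ uIcc (l t) (r t)) →
      (AtTime K t x y ↔ f.Before (SpaceTime.point x t) (SpaceTime.point y t)) := by
    intro t x y hx hy
    rw [hord t x y hx hy]
    change _ ↔ t < t ∨ t = t ∧ x ∈ uIcc (f.leftVal t) y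
    simp [hfl]
  ext ⟨z, w⟩
  constructor
  · rintro ⟨hz, hw, hzw⟩
    change f.Before z w at hzw
    have hz' := (hgraph z).1 hz
    have hw' := (hgraph w).1 hw
    rcases z with ⟨x, s⟩ | _ | _ <;> rcases w with ⟨y, t⟩ | _ | _
    · rcases hzw with h | ⟨rfl, h⟩
      · exact hlt _ _ hz' hw' (EReal.coe_lt_coe_iff.2 h)
      · exact (hsame s x y ((hH _ _).1 hz') ((hH _ _).1 hw')).2 (Or.inr ⟨rfl, h⟩)
    · exact absurd hzw (not_le.2 (EReal.bot_lt_coe s))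
    · exact hlt _ _ hz' hw' (EReal.coe_lt_top s)
    · exact hlt _ _ hz' hw' (EReal.bot_lt_coe t)
    · exact hbot
    · exact hlt _ _ hz' hw' bot_lt_top
    · exact absurd hzw (not_le.2 (EReal.coe_lt_top t))
    · exact absurd hzw (not_le.2 bot_lt_top)
    · exact htop
  · intro h
    obtain ⟨hz, hw⟩ := hfield _ _ h
    have htm := htime _ _ h
    refine ⟨(hgraph _).2 hz, (hgraph _).2 hw, ?_⟩
    change f.Before z w
    rcases z with ⟨x, s⟩ | _ | _ <;> rcases w with ⟨y, t⟩ | _ | _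
    · rcases (EReal.coe_le_coe_iff.1 htm).lt_or_eq with hst | rfl
      · exact Or.inl hst
      · exact (hsame s x y ((hH _ _).1 hz) ((hH _ _).1 hw)).1 h
    all_goals exact htm

end Relation

/-! ### Limits of flanked paths -/

/-- A dominating path through `(c, r)` exists whenever `f` is strictly below `c` at time `r`, and it
is at height at least `y` at time `u`. Such `r` are found arbitrarily close to `s`: before `s` if
`f(s-) < c`, and otherwise after `s`, in which case necessarily `s < u`. Then let `r` tend to `s`.
-/
theorem Flanked.exists_pre_ge (hA : A ⊆ upPaths) (hlim : LimClosed A) (hf : f ∈ biPaths)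
    (hfl : DominatedBy A f) (hpre : f.Pre x s y u) (hxc : x < c) (hcy : c < y) :
    ∃ g ∈ A, ∃ y', y ≤ y' ∧ g.Pre c s y' u := by
  obtain ⟨𝒱, hid, hev⟩ : ∃ 𝒱 : Ultrafilter ℝ, Tendsto (fun r => r) 𝒱 (𝓝 s) ∧
      ∀ᶠ r in (𝒱 : Filter ℝ), f.hi r < c ∧ r < u := by
    by_cases hl : f.leftVal s < c
    · obtain ⟨𝒱, h𝒱⟩ := Ultrafilter.exists_le (𝓝[<] s)
      refine ⟨𝒱, h𝒱.trans nhdsWithin_le_nhds, h𝒱 ?_⟩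
      filter_upwards [(tendsto_hi_nhdsLT hf.2 (start_lt_of_bi hf s)).eventually (gt_mem_nhds hl),
        self_mem_nhdsWithin] with r hr hrs
      exact ⟨hr, lt_of_lt_of_le hrs hpre.le⟩
    · have hr : f.rightVal s < c := by
        have := hpre.1.2
        rw [Set.mem_uIcc] at this
        grind
      have hsu : s < u := by
        refine hpre.le.lt_of_ne fun heq => ?_
        subst heq
        have := hpre.mem_uIcc
        rw [Set.mem_uIcc] at this
        grind
      obtain ⟨𝒱, h𝒱⟩ := Ultrafilter.exists_le (𝓝[>] s)
      refine ⟨𝒱, h𝒱.trans nhdsWithin_le_nhds, h𝒱 ?_⟩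
      filter_upwards [(tendsto_hi_nhdsGT hf.2 (start_le_of_bi hf s)).eventually (gt_mem_nhds hr),
        Ioo_mem_nhdsGT hsu] with r hr hrs
      exact ⟨hr, hrs.2⟩
  have : Nonempty Path := ⟨f⟩
  have hex : ∀ r, f.hi r < c ∧ r < u → ∃ g ∈ A, g.Pre c r (g.hi u) u ∧ y ≤ g.hi u := by
    rintro r ⟨hr, hru⟩
    obtain ⟨g, hg, hon, hle⟩ := hfl r c hr
    refine ⟨g, hg, hon.pre_of_lt (on_hi (hA hg)
      (hon.start_le.trans (EReal.coe_le_coe_iff.2 hru.le))) hru, ?_⟩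
    exact (On.le_hi hpre.2.1).trans (max_le_max (hle (.left u) hru) (hle (.right u) hru))
  choose! G hG hGpre hGle using hex
  obtain ⟨g, hg, hsub⟩ := hlim ℝ 𝒱 G (hev.mono hG)
  obtain ⟨y', hy', hp⟩ := hsub.exists_pre_ge (b := fun _ => y) tendsto_const_nhds hid
    tendsto_const_nhds tendsto_const_nhds (hev.mono hGle) (hev.mono hGpre)
  exact ⟨g, hg, y', hy', hp⟩

variable {ι : Type} {𝒱 : Ultrafilter ι} {B : ι → Set Path} {F : ι → Path}

/-- The intended case is `s₀ = u₀`: an ever steeper rise of the paths `F i` is matched by a jump of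
a path of `A`. -/
theorem exists_limit_pre_ge (hB : ∀ᶠ i in 𝒱, B i ⊆ upPaths ∧ LimClosed (B i))
    (hlim : LimitsIn 𝒱 B A) (hF : ∀ᶠ i in 𝒱, F i ∈ biPaths ∧ DominatedBy (B i) (F i))
    {x y : ι → EReal} {s u : ι → ℝ} {x₀ y₀ : EReal} {s₀ u₀ : ℝ}
    (hx : Tendsto x 𝒱 (𝓝 x₀)) (hs : Tendsto s 𝒱 (𝓝 s₀)) (hy : Tendsto y 𝒱 (𝓝 y₀))
    (hu : Tendsto u 𝒱 (𝓝 u₀)) (hpre : ∀ᶠ i in 𝒱, (F i).Pre (x i) (s i) (y i) (u i))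
    (hxc : x₀ < c) (hcy : c < y₀) : ∃ g ∈ A, ∃ y', y₀ ≤ y' ∧ g.Pre c s₀ y' u₀ := by
  have hex : ∀ i, ((F i ∈ biPaths ∧ DominatedBy (B i) (F i)) ∧ (B i ⊆ upPaths ∧ LimClosed (B i)) ∧
      (F i).Pre (x i) (s i) (y i) (u i) ∧ x i < c ∧ c < y i) →
      ∃ g ∈ B i, ∃ y', y i ≤ y' ∧ g.Pre c (s i) y' (u i) := fun i hi =>
    Flanked.exists_pre_ge hi.2.1.1 hi.2.1.2 hi.1.1 hi.1.2 hi.2.2.1 hi.2.2.2.1 hi.2.2.2.2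
  have hev := hF.and (hB.and (hpre.and ((hx.eventually (gt_mem_nhds hxc)).and
    (hy.eventually (lt_mem_nhds hcy)))))
  obtain ⟨i₀, -⟩ := hev.exists
  have : Nonempty Path := ⟨F i₀⟩
  choose! G hG y' hy' hGpre using hex
  obtain ⟨g, hg, hsub⟩ := hlim G (hev.mono hG)
  obtain ⟨z, hz, hp⟩ := hsub.exists_pre_ge tendsto_const_nhds hs hu hy (hev.mono hy')
    (hev.mono hGpre)
  exact ⟨g, hg, z, hz, hp⟩

/-- Dominating paths for `F i` through `(c, s)` have a sublimit in `A`. At a fixed time the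
comparison only survives as `f.lo u ≤ g.hi u`, but `lo` and `hi` have the same one-sided limits, so
it holds on the split line. -/
theorem DominatedBy.limit (hA : A ⊆ upPaths) (hB : ∀ᶠ i in 𝒱, B i ⊆ upPaths)
    (hlim : LimitsIn 𝒱 B A) (hF : ∀ᶠ i in 𝒱, F i ∈ biPaths ∧ DominatedBy (B i) (F i))
    (hf : f ∈ biPaths) (hsub : SubLimit 𝒱 F f) : DominatedBy A f := by
  intro s c hc
  have hev : ∀ᶠ i in 𝒱, (F i).hi s < c := by
    by_contra hcon
    rw [← Ultrafilter.eventually_not] at hcon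
    obtain ⟨v, hv⟩ := exists_tendsto_ultrafilter 𝒱 fun i => (F i).hi s
    have hon := hsub.on hv tendsto_const_nhds
      (hF.mono fun i hi => on_hi hi.1.2 (start_le_of_bi hi.1 s))
    exact absurd ((ge_of_tendsto hv (hcon.mono fun i hi => not_lt.1 hi)).trans hon.le_hi)
      (not_le.2 hc)
  have : Nonempty Path := ⟨f⟩
  have hall := hev.and (hF.and hB)
  have hex : ∀ i, ((F i).hi s < c ∧ (F i ∈ biPaths ∧ DominatedBy (B i) (F i)) ∧ B i ⊆ upPaths) →
      ∃ g ∈ B i, g.On c s ∧ ∀ p : SplitReal, s < p.time → (F i).toFun p ≤ g.toFun p :=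
    fun i hi => hi.2.1.2 s c hi.1
  choose! G hG hon hle using hex
  obtain ⟨g, hg, hgsub⟩ := hlim G (hall.mono hG)
  have hgon := hgsub.on tendsto_const_nhds tendsto_const_nhds (hall.mono hon)
  refine ⟨g, hg, hgon, fun p hp => ?_⟩
  have hcmp : ∀ u, s < u → f.lo u ≤ g.hi u := by
    intro u hsu
    obtain ⟨v, hv⟩ := exists_tendsto_ultrafilter 𝒱 fun i => (F i).lo u
    obtain ⟨w, hw⟩ := exists_tendsto_ultrafilter 𝒱 fun i => (G i).hi u
    have h1 := hsub.on hv tendsto_const_nhds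
      (hF.mono fun i hi => on_lo hi.1.2 (start_le_of_bi hi.1 u))
    have h2 := hgsub.on hw tendsto_const_nhds (hall.mono fun i hi => on_hi (hi.2.2 (hG i hi))
      ((hon i hi).start_le.trans (EReal.coe_le_coe_iff.2 hsu.le)))
    refine h1.lo_le.trans (le_trans (le_of_tendsto_of_tendsto hv hw ?_) h2.le_hi)
    filter_upwards [hall] with i hi
    exact ((F i).lo_le_hi u).trans
      (max_le_max (hle i hi (.left u) hsu) (hle i hi (.right u) hsu))
  refine toFun_le_of_frequently (hA hg) (hgon.start_le.trans_lt (EReal.coe_lt_coe_iff.2 hp))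
    (tendsto_lo_side hf.2 (start_lt_of_bi hf _)) (Eventually.frequently ?_)
  filter_upwards [side_le p (lt_mem_nhds hp)] with u hu using hcmp u hu

/-- Limits of flanked paths exist and are flanked, provided the limiting set is non-crossing. -/
theorem exists_limit_flanked (hA : A ⊆ upPaths) (hnc : IsNonCrossing A)
    (hB : ∀ᶠ i in 𝒱, B i ⊆ upPaths ∧ LimClosed (B i))
    (hlim : LimitsIn 𝒱 B A) (hF : ∀ᶠ i in 𝒱, F i ∈ biPaths ∧ Flanked (B i) (F i)) :
    ∃ f ∈ biPaths, Tendsto F 𝒱 (𝓝 f) ∧ Flanked A f := by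
  -- The hyperspace of a compact space is compact. It remains to recognise `K` as the graph of a
  -- path.
  obtain ⟨K, hK⟩ := exists_tendsto_ultrafilter 𝒱 fun i => (F i).compactGraph₂
  have hmem : ∀ {z : ι → SpaceTime × SpaceTime} {w}, Tendsto z 𝒱 (𝓝 w) →
      (∀ᶠ i in 𝒱, z i ∈ (F i).graph₂) → w ∈ K := fun hz h => mem_of_tendsto_compacts hK hz h
  have hex : ∀ z w, (z, w) ∈ K → ∃ zi wi : ι → SpaceTime, Tendsto zi 𝒱 (𝓝 z) ∧ Tendsto wi 𝒱 (𝓝 w) ∧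
      ∀ i, (zi i, wi i) ∈ (F i).graph₂ := by
    intro z w hzw
    obtain ⟨v, hv, hvm⟩ := exists_tendsto_of_mem_compacts hK hzw
    exact ⟨fun i => (v i).1, fun i => (v i).2, (continuous_fst.tendsto _).comp hv,
      (continuous_snd.tendsto _).comp hv, hvm⟩
  have hcoord : ∀ {t x y}, AtTime (K : Set (SpaceTime × SpaceTime)) t x y →
      ∃ (xi yi : ι → EReal) (si ui : ι → ℝ), Tendsto xi 𝒱 (𝓝 x) ∧ Tendsto yi 𝒱 (𝓝 y) ∧
        Tendsto si 𝒱 (𝓝 t) ∧ Tendsto ui 𝒱 (𝓝 t) ∧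
        ∀ᶠ i in 𝒱, (F i).Pre (xi i) (si i) (yi i) (ui i) := by
    intro t x y hxy
    obtain ⟨zi, wi, hz, hw, hzw⟩ := hex _ _ hxy
    obtain ⟨xi, si, hx, hs, hzi⟩ := SpaceTime.exists_coordinates hz
    obtain ⟨yi, ui, hy, hu, hwi⟩ := SpaceTime.exists_coordinates hw
    refine ⟨xi, yi, si, ui, hx, hy, hs, hu, ?_⟩
    filter_upwards [hzi, hwi] with i h1 h2
    have := hzw i
    rwa [h1, h2] at this
  -- Antisymmetry is the only property that limits of graphs can lose. For `x < c < d < y`, flanking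
  -- from the right yields a path of `A` that rises from `c` to at least `y`, and flanking from the
  -- left one that falls from `d` to at most `x`, both at time `t`.
  have hlt : ∀ t x y, AtTime (K : Set (SpaceTime × SpaceTime)) t x y → AtTime K t y x → ¬ x < y := by
    intro t x y hxy hyx hlt
    obtain ⟨c, hxc, hc⟩ := exists_between hlt
    obtain ⟨d, hcd, hdy⟩ := exists_between hc
    obtain ⟨xi, yi, si, ui, hx, hy, hs, hu, hpre⟩ := hcoord hxy
    obtain ⟨g, hg, y', hyy', hgpre⟩ := exists_limit_pre_ge hB hlim
      (hF.mono fun i hi => ⟨hi.1, hi.2.1⟩) hx hs hy hu hpre hxc (hcd.trans hdy)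
    obtain ⟨xi, yi, si, ui, hx, hy, hs, hu, hpre⟩ := hcoord hyx
    obtain ⟨h, hh, x', hxx', hhpre⟩ := exists_limit_pre_ge
      (hB.mono fun i hi => ⟨negSet_subset_up hi.1, hi.2.negSet⟩) hlim.negSet
      (F := fun i => (F i).neg) (hF.mono fun i hi => ⟨neg_mem_bi.2 hi.1, hi.2.2⟩) hx.neg hs hy.neg hu
      (hpre.mono fun i hi => neg_pre.2 (by simpa using hi))
      (EReal.neg_lt_neg_iff.2 hdy) (EReal.neg_lt_neg_iff.2 (hxc.trans hcd))
    have hhpre' : h.neg.Pre d t (-x') t := neg_pre.2 (by simpa using hhpre)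
    have hx' : -x' ≤ x := EReal.neg_le.1 hxx'
    exact hnc.no_opposite_jumps hg hh hgpre hhpre' ((hcd.trans hdy).trans_le hyy')
      (hx'.trans_lt (hxc.trans hcd)) hcd (hx'.trans_lt (hlt.trans_le hyy'))
  obtain ⟨f, hf, hfK⟩ := exists_path_of_relation (K := (K : Set (SpaceTime × SpaceTime)))
    K.isCompact.isClosed
    (fun z w hzw => by
      obtain ⟨zi, wi, hz, hw, hzw⟩ := hex z w hzw
      exact ⟨hmem (hz.prodMk_nhds hz) (Eventually.of_forall fun i => refl_mem_graph₂ (hzw i).1),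
        hmem (hw.prodMk_nhds hw) (Eventually.of_forall fun i => refl_mem_graph₂ (hzw i).2.1)⟩)
    (fun z w hz hw => by
      obtain ⟨zi, _, hz, _, hzz⟩ := hex z z hz
      obtain ⟨wi, _, hw, _, hww⟩ := hex w w hw
      have : ∀ᶠ i in (𝒱 : Filter ι), (zi i, wi i) ∈ (F i).graph₂ ∨ (wi i, zi i) ∈ (F i).graph₂ :=
        Eventually.of_forall fun i => graph₂_total (hzz i).1 (hww i).1
      exact (Ultrafilter.eventually_or.1 this).imp (fun h => hmem (hz.prodMk_nhds hw) h)
        (fun h => hmem (hw.prodMk_nhds hz) h))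
    (fun z w hzw => by
      obtain ⟨zi, wi, hz, hw, hzw⟩ := hex z w hzw
      exact le_of_tendsto_of_tendsto ((SpaceTime.continuous_time.tendsto z).comp hz)
        ((SpaceTime.continuous_time.tendsto w).comp hw)
        (Eventually.of_forall fun i => time_le_of_mem_graph₂ (hzw i)))
    (fun t x y c hxy hc => by
      obtain ⟨xi, yi, si, ui, hx, hy, hs, hu, hpre⟩ := hcoord hxy
      -- This is `c` clamped to the segment between `xi i` and `yi i`, so that the intermediate
      -- value property applies while the limit is still `c`.
      set ci : ι → EReal := fun i => max (min (xi i) (yi i)) (min c (max (xi i) (yi i))) with hci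
      have hcl : Tendsto ci 𝒱 (𝓝 c) := by
        have h1 : Tendsto ci 𝒱 (𝓝 (max (min x y) (min c (max x y)))) :=
          (hx.min hy).max (tendsto_const_nhds.min (hx.max hy))
        rwa [min_eq_left hc.2, max_eq_right hc.1] at h1
      have hcm : ∀ i, ci i ∈ uIcc (xi i) (yi i) := fun i =>
        ⟨le_max_left _ _, max_le min_le_max (min_le_right _ _)⟩
      have hexr : ∀ i, (F i ∈ biPaths ∧ (F i).Pre (xi i) (si i) (yi i) (ui i)) →
          ∃ r, (F i).Pre (xi i) (si i) (ci i) r ∧ (F i).Pre (ci i) r (yi i) (ui i) :=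
        fun i hi => hi.2.exists_between hi.1 (hcm i)
      choose! ri h1 h2 using hexr
      have hall := (hF.mono fun i hi => hi.1).and hpre
      have hr : Tendsto ri 𝒱 (𝓝 t) := tendsto_of_tendsto_of_tendsto_of_le_of_le' hs hu
        (hall.mono fun i hi => (h1 i hi).le) (hall.mono fun i hi => (h2 i hi).le)
      exact ⟨hmem ((SpaceTime.tendsto_point hx hs).prodMk_nhds (SpaceTime.tendsto_point hcl hr))
          (hall.mono fun i hi => h1 i hi),
        hmem ((SpaceTime.tendsto_point hcl hr).prodMk_nhds (SpaceTime.tendsto_point hy hu))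
          (hall.mono fun i hi => h2 i hi)⟩)
    (fun t => by
      obtain ⟨v, hv⟩ := exists_tendsto_ultrafilter 𝒱 fun i => (F i).leftVal t
      have hp := SpaceTime.tendsto_point hv (tendsto_const_nhds (x := t))
      exact ⟨v, hmem (hp.prodMk_nhds hp)
        (hF.mono fun i hi => (on_leftVal hi.1.2 (start_le_of_bi hi.1 t)).refl)⟩)
    (hmem tendsto_const_nhds (hF.mono fun i hi => ⟨hi.1.1, hi.1.1, le_rfl⟩))
    (hmem tendsto_const_nhds (hF.mono fun i hi => ⟨hi.1.2, hi.1.2, le_rfl⟩))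
    (fun t x y hxy hyx => le_antisymm (not_lt.1 (hlt t y x hyx hxy)) (not_lt.1 (hlt t x y hxy hyx)))
  have hfK' : f.compactGraph₂ = K := SetLike.coe_injective hfK
  have htend : Tendsto F 𝒱 (𝓝 f) :=
    isometry_compactGraph₂.isEmbedding.isInducing.tendsto_nhds_iff.2 (hfK' ▸ hK)
  have hsub := subLimit_of_tendsto htend
  have hB' := hB.mono fun i hi => hi.1
  refine ⟨f, hf, htend, ?_, ?_⟩
  · exact DominatedBy.limit hA hB' hlim (hF.mono fun i hi => ⟨hi.1, hi.2.1⟩) hf hsub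
  · exact DominatedBy.limit (negSet_subset_up hA) (hB'.mono fun i hi => negSet_subset_up hi)
      hlim.negSet (F := fun i => (F i).neg) (hF.mono fun i hi => ⟨neg_mem_bi.2 hi.1, hi.2.2⟩)
      (neg_mem_bi.2 hf) hsub.neg

end Weaves

namespace Weaves
open Weaves.Path

/-! ### Deterministic weaves and compactness of their flows -/

variable {f g h : Path} {A B : Set Path} {a b c d : EReal} {s t u : ℝ}

/-- The properties of a deterministic weave that only involve points at finite times. -/
structure IsWeave (B : Set Path) : Prop where
  subset_up : B ⊆ upPaths
  nonCrossing : IsNonCrossing B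
  limClosed : LimClosed B
  covers : ∀ x t, ∃ g ∈ B, g.On x t

theorem IsWeave.negSet (hB : IsWeave B) : IsWeave (negSet B) where
  subset_up := negSet_subset_up hB.subset_up
  nonCrossing := hB.nonCrossing.negSet
  limClosed := hB.limClosed.negSet
  covers x t := by
    obtain ⟨g, hg, hon⟩ := hB.covers (-x) t
    exact ⟨g.neg, neg_mem_negSet.2 hg, neg_on.2 hon⟩

/-- With `IsWeave.mem_flow` this identifies the flow with the flanked bi-infinite paths, the form in
which it passes to limits. -/
theorem IsWeave.flanked (hB : IsWeave B) (hf : f ∈ flow B) : Flanked B f :=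
  ⟨flow_dominatedBy hB.subset_up hB.covers hf,
    flow_dominatedBy hB.negSet.subset_up hB.negSet.covers (flow_neg hf)⟩

theorem IsWeave.mem_flow (hB : IsWeave B) (hf : f ∈ biPaths) (hfl : Flanked B f) : f ∈ flow B :=
  hfl.mem_flow hB.subset_up hB.nonCrossing hB.limClosed hf

theorem IsWeave.isCompact_flow (hB : IsWeave B) : IsCompact (flow B) := by
  refine isCompact_iff_ultrafilter_le_nhds.2 fun 𝒱 h𝒱 => ?_
  have hmem : ∀ᶠ f in (𝒱 : Filter Path), f ∈ flow B := le_principal_iff.1 h𝒱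
  obtain ⟨f, hf, hlim, hfl⟩ := exists_limit_flanked (F := fun f => f) hB.subset_up hB.nonCrossing
    (Eventually.of_forall fun _ => ⟨hB.subset_up, hB.limClosed⟩) (hB.limClosed _ 𝒱)
    (hmem.mono fun f hf => ⟨hf.1, hB.flanked hf⟩)
  exact ⟨f, hB.mem_flow hf hfl, hlim⟩

/-! ### Times at which the paths of a non-crossing set are ordered -/

/-- Paths of `B` that pass through different points at time `s` are ordered after time `s`. -/
def OrderedAt (B : Set Path) (s : ℝ) : Prop :=
  ∀ g ∈ B, ∀ h ∈ B, ∀ c d, c < d → g.On c s → h.On d s →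
    ∀ p : SplitReal, s < p.time → g.toFun p ≤ h.toFun p

theorem OrderedAt.le (hs : OrderedAt B s) (hg : g ∈ B) (hh : h ∈ B) (hcd : c < d) (hgc : g.On c s)
    (hhd : h.On d s) (hst : s < t) : g.lo t ≤ h.lo t ∧ g.hi t ≤ h.hi t := by
  have := hs g hg h hh c d hcd hgc hhd
  exact ⟨min_le_min (this (.left t) hst) (this (.right t) hst),
    max_le_max (this (.left t) hst) (this (.right t) hst)⟩

/-- Times at which a path passes below `q`, another path leaves above `q`, but at time `r` the
paths are separated by `q'` in the opposite order. -/
def reorderingTimes (B : Set Path) (q q' : EReal) (r : ℝ) : Set ℝ :=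
  {s | s < r ∧ ∃ g ∈ B, ∃ h ∈ B, ∃ c < q, g.On c s ∧ h.start ≤ s ∧ q < h.rightVal s ∧
    h.hi r < q' ∧ q' < g.lo r}

/-- Every point `s` of the set is isolated from the right. The path `h` that belongs to `s` stays
above `q` for a while; if `s'` in the set came that soon, the path `g` that belongs to `s'` would be
below `h` at `s'` and above it at `r`. -/
theorem countable_reorderingTimes (hB : B ⊆ upPaths) (hnc : IsNonCrossing B) (q q' : EReal)
    (r : ℝ) : (reorderingTimes B q q' r).Countable := by
  set S := reorderingTimes B q q' r with hS
  suffices ∀ s ∈ S, 𝓝[S ∩ Ioi s] s = ⊥ from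
    Set.Countable.mono (s₂ := {s | s ∈ S ∧ 𝓝[S ∩ Ioi s] s = ⊥}) (fun s hs => ⟨hs, this s hs⟩)
      countable_setOfPred_isolated_right_within
  intro s hs
  rw [inter_comm, nhdsWithin_inter', inf_principal_eq_bot]
  obtain ⟨hsr, -, -, h, hh, -, -, -, hst, hq, hhr, -⟩ := hs
  filter_upwards [(tendsto_lo_nhdsGT (hB hh) hst).eventually (lt_mem_nhds hq),
    self_mem_nhdsWithin] with s' hs' hss' hmem
  obtain ⟨hs'r, g, hg, -, -, c, hc, hon, -, -, -, hgr⟩ := hmem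
  have hss'' : (s : EReal) < s' := EReal.coe_lt_coe_iff.2 hss'
  have hs'r' : (s' : EReal) < r := EReal.coe_lt_coe_iff.2 hs'r
  obtain ⟨h', hh', g', hg', ehh, egg, hle | hle⟩ := hnc h hh g hg
  · have := (lo_mono hle s').trans (egg.on hon).lo_le
    rw [ehh.lo_eq (hB hh) hh' (hst.trans_lt hss'')] at this
    exact absurd (hs'.trans_le this) (not_lt.2 hc.le)
  · have := lo_mono hle r
    rw [ehh.lo_eq (hB hh) hh' ((hst.trans_lt hss'').trans hs'r'),
      egg.lo_eq (hB hg) hg' (hon.start_le.trans_lt hs'r')] at this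
    exact absurd (hgr.trans_le (this.trans (h.lo_le_hi r))) (not_lt.2 hhr.le)

/-- A failure at `s` means that `h` lies strictly below `g` at some later time, which may be taken
rational. Either `s` is a reordering time with rational levels, for the set or its reflection, or
both reorderings happen by jumps at `s` itself. -/
theorem countable_not_orderedAt (hB : B ⊆ upPaths) (hnc : IsNonCrossing B) :
    {s | ¬ OrderedAt B s}.Countable := by
  have hcount : (⋃ (q : ℚ) (q' : ℚ) (r : ℚ), (reorderingTimes B ((q : ℝ) : EReal) ((q' : ℝ) : EReal) r ∪
      reorderingTimes (negSet B) ((q : ℝ) : EReal) ((q' : ℝ) : EReal) r)).Countable :=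
    countable_iUnion fun q => countable_iUnion fun q' => countable_iUnion fun r =>
      (countable_reorderingTimes hB hnc _ _ _).union
        (countable_reorderingTimes (negSet_subset_up hB) hnc.negSet _ _ _)
  refine hcount.mono fun s hs => ?_
  simp only [OrderedAt, mem_ofPred_eq, not_forall, not_le] at hs
  obtain ⟨g, hg, h, hh, c, d, hcd, hgc, hhd, p, hsp, hlt⟩ := hs
  have hsp' : (s : EReal) < p.time := EReal.coe_lt_coe_iff.2 hsp
  obtain ⟨-, ⟨hr1, hsr⟩, r, rfl⟩ := ((frequently_side_mem
    Rat.denseRange_cast p).and_eventually ((eventually_hi_lt_lo (hB hh) (hB hg)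
      (hhd.start_le.trans_lt hsp') (hgc.start_le.trans_lt hsp') hlt).and
      (side_le p (lt_mem_nhds hsp)))).exists.imp fun _ h => h.symm
  simp only [mem_iUnion]
  have hsr' : (s : EReal) < (r : ℝ) := EReal.coe_lt_coe_iff.2 hsr
  by_cases h1 : c < h.rightVal s
  · obtain ⟨q, hq1, hq2⟩ := EReal.lt_iff_exists_rat_btwn.1 h1
    obtain ⟨q', hq'1, hq'2⟩ := EReal.lt_iff_exists_rat_btwn.1 hr1
    exact ⟨q, q', r, Or.inl ⟨hsr, g, hg, h, hh, c, hq1, hgc, hhd.start_le, hq2, hq'1, hq'2⟩⟩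
  by_cases h2 : g.rightVal s < d
  · obtain ⟨q, hq1, hq2⟩ := EReal.lt_iff_exists_rat_btwn.1 (EReal.neg_lt_neg_iff.2 h2)
    obtain ⟨q', hq'1, hq'2⟩ := EReal.lt_iff_exists_rat_btwn.1 (EReal.neg_lt_neg_iff.2 hr1)
    exact ⟨q, q', r, Or.inr ⟨hsr, h.neg, neg_mem_negSet.2 hh, g.neg, neg_mem_negSet.2 hg, -d, hq1,
      neg_on.2 (by simpa using hhd), hgc.start_le, hq2, by simpa using hq'1, by simpa using hq'2⟩⟩
  -- Here `h` falls from `d` to at most `c` while `g` rises from `c` to at least `d`, which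
  -- non-crossing forbids once the order at time `r` is known.
  exfalso
  obtain ⟨g', hg', h', hh', egg, ehh, hle | hle⟩ := hnc g hg h hh
  · have := lo_mono hle r
    rw [egg.lo_eq (hB hg) hg' (hgc.start_le.trans_lt hsr'),
      ehh.lo_eq (hB hh) hh' (hhd.start_le.trans_lt hsr')] at this
    exact absurd (this.trans (h.lo_le_hi r)) (not_le.2 hr1)
  · have h3 := (ehh.on hhd).2
    have h4 := (egg.on hgc).2
    rw [ehh.rightVal_eq (hB hh) hh' hhd.start_le] at h3
    rw [egg.rightVal_eq (hB hg) hg' hgc.start_le] at h4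
    have h5 : h'.leftVal s ≤ g'.leftVal s := hle _
    rw [mem_uIcc] at h3 h4
    grind

/-! ### Separating functions -/

/-- A function on a set `D` of times that is not crossed by paths of `B`. -/
def Separating (B : Set Path) (D : Set ℝ) (x : ℝ → EReal) : Prop :=
  ∀ g ∈ B, ∀ s ∈ D, ∀ t ∈ D, s < t → ∀ c, g.On c s →
    (c < x s → g.lo t ≤ x t) ∧ (x s < c → x t ≤ g.hi t)

theorem Separating.neg {D : Set ℝ} {x : ℝ → EReal} (hx : Separating B D x) :
    Separating (negSet B) D fun t => -x t := by
  intro g hg s hs t ht hst c hc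
  obtain ⟨h1, h2⟩ := hx _ hg s hs t ht hst (-c) (neg_on.2 (by simpa using hc))
  rw [neg_lo, neg_hi] at *
  refine ⟨fun h => ?_, fun h => ?_⟩
  · have := h2 (EReal.lt_neg_comm.1 h)
    exact EReal.le_neg_of_le_neg this
  · have := h1 (EReal.neg_lt_comm.1 h)
    exact EReal.neg_le_of_neg_le this

theorem Separating.iSup {D : Set ℝ} {κ : Sort*} {x : κ → ℝ → EReal}
    (hx : ∀ k, Separating B D (x k)) : Separating B D fun t => ⨆ k, x k t := by
  intro g hg s hs t ht hst c hc
  refine ⟨fun h => ?_, fun h => iSup_le fun k => ?_⟩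
  · obtain ⟨k, hk⟩ := lt_iSup_iff.1 h
    exact ((hx k g hg s hs t ht hst c hc).1 hk).trans (le_iSup (fun k => x k t) k)
  · exact (hx k g hg s hs t ht hst c hc).2 ((le_iSup (fun k => x k s) k).trans_lt h)

/-- The smallest separating function that takes the value `a` at time `s`. -/
def lowerFn (B : Set Path) (a : EReal) (s t : ℝ) : EReal :=
  if s < t then sSup {y | ∃ g ∈ B, ∃ c < a, g.On c s ∧ g.lo t = y}
  else if t < s then sSup {c | ∃ g ∈ B, g.On c t ∧ g.hi s < a}
  else a

theorem lowerFn_of_lt (hst : s < t) :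
    lowerFn B a s t = sSup {y | ∃ g ∈ B, ∃ c < a, g.On c s ∧ g.lo t = y} := if_pos hst

theorem lowerFn_of_gt (hts : t < s) : lowerFn B a s t = sSup {c | ∃ g ∈ B, g.On c t ∧ g.hi s < a} := by
  rw [lowerFn, if_neg hts.le.not_gt, if_pos hts]

theorem lowerFn_self : lowerFn B a s s = a := by simp [lowerFn]

/-- In each position of `s` relative to `r < t`, the path `g` is compared with the paths that define
the function, and orderedness at a time of `D` carries the comparison to later times. -/
theorem separating_lowerFn (hB : B ⊆ upPaths) {D : Set ℝ} (hD : ∀ r ∈ D, OrderedAt B r)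
    (hs : s ∈ D) : Separating B D (lowerFn B a s) := by
  intro g hg r hr t ht hrt c hc
  have hlo : ∀ h ∈ B, ∀ e q q', h.On e q → q ≤ q' → h.On (h.lo q') q' := fun h hh e q q' hon hq =>
    on_lo (hB hh) (hon.start_le.trans (EReal.coe_le_coe_iff.2 hq))
  have hhi : ∀ h ∈ B, ∀ e q q', h.On e q → q ≤ q' → h.On (h.hi q') q' := fun h hh e q q' hon hq =>
    on_hi (hB hh) (hon.start_le.trans (EReal.coe_le_coe_iff.2 hq))
  rcases lt_trichotomy s r with hsr | rfl | hrs
  · rw [lowerFn_of_lt hsr, lowerFn_of_lt (hsr.trans hrt)]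
    refine ⟨fun hlt => ?_, fun hlt => sSup_le ?_⟩
    · obtain ⟨-, ⟨h, hh, a', ha', hon, rfl⟩, hlt⟩ := lt_sSup_iff.1 hlt
      exact ((hD r hr).le hg hh hlt hc (hlo h hh _ _ _ hon hsr.le) hrt).1.trans
        (le_sSup ⟨h, hh, a', ha', hon, rfl⟩)
    · rintro - ⟨h, hh, a', ha', hon, rfl⟩
      have : h.lo r < c := hlt.trans_le' (le_sSup ⟨h, hh, a', ha', hon, rfl⟩)
      exact (h.lo_le_hi t).trans
        ((hD r hr).le hh hg this (hlo h hh _ _ _ hon hsr.le) hc hrt).2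
  · rw [lowerFn_self, lowerFn_of_lt hrt]
    refine ⟨fun hlt => le_sSup ⟨g, hg, c, hlt, hc, rfl⟩, fun hlt => sSup_le ?_⟩
    rintro - ⟨h, hh, a', ha', hon, rfl⟩
    exact (h.lo_le_hi t).trans ((hD s hr).le hh hg (ha'.trans hlt) hon hc hrt).2
  · have hmem : lowerFn B a s r < c → a ≤ g.hi s := fun hlt => by
      by_contra! hcon
      rw [lowerFn_of_gt hrs] at hlt
      exact absurd hlt (not_lt.2 (le_sSup ⟨g, hg, hc, hcon⟩))
    have hup : c < lowerFn B a s r → g.hi s < a := fun hlt => by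
      rw [lowerFn_of_gt hrs] at hlt
      obtain ⟨e, ⟨h, hh, hon, hlta⟩, hlt⟩ := lt_sSup_iff.1 hlt
      exact ((hD r hr).le hg hh hlt hc hon hrs).2.trans_lt hlta
    rcases lt_trichotomy s t with hst | rfl | hts
    · refine ⟨fun hlt => ?_, fun hlt => ?_⟩ <;> rw [lowerFn_of_lt hst]
      · exact le_sSup ⟨g, hg, _, hup hlt, hhi g hg _ _ _ hc hrs.le, rfl⟩
      · refine sSup_le ?_
        rintro - ⟨h, hh, a', ha', hon, rfl⟩
        exact (h.lo_le_hi t).trans ((hD s hs).le hh hg (ha'.trans_le (hmem hlt)) hon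
          (hhi g hg _ _ _ hc hrs.le) hst).2
    · rw [lowerFn_self]
      exact ⟨fun hlt => (g.lo_le_hi s).trans (hup hlt).le, hmem⟩
    · refine ⟨fun hlt => ?_, fun hlt => ?_⟩ <;> rw [lowerFn_of_gt hts]
      · exact le_sSup ⟨g, hg, hlo g hg _ _ _ hc hrt.le, hup hlt⟩
      · refine sSup_le ?_
        rintro e ⟨h, hh, hon, hlta⟩
        by_contra! hcon
        have := ((hD t ht).le hg hh hcon (hhi g hg _ _ _ hc hrt.le) hon hts).2
        exact absurd ((hmem hlt).trans this) (not_le.2 hlta)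

/-! ### The path associated with a separating function -/

/-- Both filters approach the same time from the same side. Coming from the left, the first time is
chosen before the second; coming from the right, the second is chosen before the first. Either way
they can be coupled in increasing order. -/
theorem exists_ultrafilter_pair {p : SplitReal} {𝒰 𝒰' : Filter ℝ} [𝒰.NeBot] [𝒰'.NeBot]
    (h : 𝒰 ≤ side p) (h' : 𝒰' ≤ side p) :
    ∃ 𝒲 : Ultrafilter (ℝ × ℝ), Tendsto Prod.fst (𝒲 : Filter (ℝ × ℝ)) 𝒰 ∧
      Tendsto Prod.snd (𝒲 : Filter (ℝ × ℝ)) 𝒰' ∧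
      ∀ᶠ w in (𝒲 : Filter (ℝ × ℝ)), w.1 < w.2 := by
  have hfr : ∃ᶠ w in 𝒰 ×ˢ 𝒰', w.1 < w.2 := by
    rw [frequently_iff]
    intro U hU
    obtain ⟨U₁, h₁, U₂, h₂, hsub⟩ := mem_prod_iff.1 hU
    rcases side_cases p with hp | hp <;> rw [hp] at h h'
    · obtain ⟨s, hs, hst⟩ := Filter.nonempty_of_mem (Filter.inter_mem h₁ (h self_mem_nhdsWithin))
      obtain ⟨u, hu, hsu, -⟩ := Filter.nonempty_of_mem (Filter.inter_mem h₂ (h' (Ioo_mem_nhdsLT hst)))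
      exact ⟨(s, u), hsub ⟨hs, hu⟩, hsu⟩
    · obtain ⟨u, hu, htu⟩ := Filter.nonempty_of_mem (Filter.inter_mem h₂ (h' self_mem_nhdsWithin))
      obtain ⟨s, hs, -, hsu⟩ := Filter.nonempty_of_mem (Filter.inter_mem h₁ (h (Ioo_mem_nhdsGT htu)))
      exact ⟨(s, u), hsub ⟨hs, hu⟩, hsu⟩
  have : (𝒰 ×ˢ 𝒰' ⊓ 𝓟 {w | w.1 < w.2}).NeBot := frequently_mem_iff_neBot.1 hfr
  obtain ⟨𝒲, h𝒲⟩ := Ultrafilter.exists_le (𝒰 ×ˢ 𝒰' ⊓ 𝓟 {w | w.1 < w.2})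
  exact ⟨𝒲, tendsto_fst.mono_left (h𝒲.trans inf_le_left),
    tendsto_snd.mono_left (h𝒲.trans inf_le_left), h𝒲 (mem_inf_of_right (mem_principal_self _))⟩

section
variable {D : Set ℝ} {x : ℝ → EReal}

/-- A path of `B` through height `c` at the earlier of two coupled times lies above `x` there, so it
is still above `x`, near `l'`, at the later one. Both times tend to `p.time`, which gives a jump in
the limit. -/
theorem Separating.exists_pre_ge (hB : IsWeave B) (hx : Separating B D x) {p : SplitReal}
    {𝒰 𝒰' : Filter ℝ} [𝒰.NeBot] [𝒰'.NeBot] (h : 𝒰 ≤ side p ⊓ 𝓟 D) (h' : 𝒰' ≤ side p ⊓ 𝓟 D)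
    {l l' : EReal} (hl : Tendsto x 𝒰 (𝓝 l)) (hl' : Tendsto x 𝒰' (𝓝 l')) (hc : l < c) :
    ∃ g ∈ B, ∃ y, l' ≤ y ∧ g.Pre c p.time y p.time := by
  obtain ⟨𝒲, h1, h2, hlt⟩ := exists_ultrafilter_pair (h.trans inf_le_left) (h'.trans inf_le_left)
  have hD1 := h1.eventually (h (mem_inf_of_right (mem_principal_self D)))
  have hD2 := h2.eventually (h' (mem_inf_of_right (mem_principal_self D)))
  have ht1 := h1.mono_right ((h.trans inf_le_left).trans (side_le p))
  have ht2 := h2.mono_right ((h'.trans inf_le_left).trans (side_le p))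
  choose G hG hGon using fun w : ℝ × ℝ => hB.covers c w.1
  obtain ⟨g, hg, hsub⟩ := hB.limClosed _ 𝒲 G (Eventually.of_forall hG)
  obtain ⟨y, hy, hpre⟩ := hsub.exists_pre_ge (x := fun _ => c) (y := fun w => (G w).hi w.2)
    (b := fun w => x w.2) tendsto_const_nhds ht1 ht2 (hl'.comp h2) (by
      filter_upwards [hD1, hD2, hlt, (hl.comp h1).eventually (gt_mem_nhds hc)] with w hw1 hw2 hw hwc
      exact (hx _ (hG w) _ hw1 _ hw2 hw c (hGon w)).2 hwc) (by
      filter_upwards [hlt] with w hw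
      exact (hGon w).pre_of_lt (on_hi (hB.subset_up (hG w))
        ((hGon w).start_le.trans (EReal.coe_le_coe_iff.2 hw.le))) hw)
  exact ⟨g, hg, y, hy, hpre⟩

theorem side_inf_neBot (hD : Dense D) (p : SplitReal) : (side p ⊓ 𝓟 D).NeBot :=
  frequently_mem_iff_neBot.1 (frequently_side_mem hD p)

/-- Two different limits on the same side would, by coupling the times in either order, force
opposite jumps of two paths of `B` at `p.time`. -/
theorem Separating.exists_limit (hB : IsWeave B) (hx : Separating B D x) (hD : Dense D)
    (p : SplitReal) : ∃ l, Tendsto x (side p ⊓ 𝓟 D) (𝓝 l) := by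
  have key : ∀ 𝒰 𝒰' : Ultrafilter ℝ, ↑𝒰 ≤ side p ⊓ 𝓟 D → ↑𝒰' ≤ side p ⊓ 𝓟 D → ∀ l l',
      Tendsto x 𝒰 (𝓝 l) → Tendsto x 𝒰' (𝓝 l') → ¬ l < l' := by
    intro 𝒰 𝒰' h h' l l' hl hl' hlt
    obtain ⟨c, hlc, hc⟩ := exists_between hlt
    obtain ⟨d, hcd, hdl⟩ := exists_between hc
    obtain ⟨g, hg, y, hy, hgpre⟩ := hx.exists_pre_ge hB h h' hl hl' hlc
    obtain ⟨k, hk, z, hz, hkpre⟩ := hx.neg.exists_pre_ge hB.negSet h' h hl'.neg hl.neg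
      (EReal.neg_lt_neg_iff.2 hdl)
    have hkpre' : k.neg.Pre d p.time (-z) p.time := neg_pre.2 (by simpa using hkpre)
    have hz' : -z ≤ l := EReal.neg_le.1 hz
    exact hB.nonCrossing.no_opposite_jumps hg hk hgpre hkpre' ((hcd.trans hdl).trans_le hy)
      (hz'.trans_lt (hlc.trans hcd)) hcd (hz'.trans_lt (hlt.trans_le hy))
  have := side_inf_neBot hD p
  obtain ⟨𝒰₀, h₀⟩ := Ultrafilter.exists_le (side p ⊓ 𝓟 D)
  obtain ⟨l, hl⟩ := exists_tendsto_ultrafilter 𝒰₀ x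
  refine ⟨l, (tendsto_iff_ultrafilter _ _ _).2 fun 𝒰 h => ?_⟩
  obtain ⟨l', hl'⟩ := exists_tendsto_ultrafilter 𝒰 x
  rwa [le_antisymm (not_lt.1 (key _ _ h h₀ _ _ hl' hl)) (not_lt.1 (key _ _ h₀ h _ _ hl hl'))]

/-- Near `p` in the split line, all points other than `p` have times on the side of `p`. This makes
one-sided limits depend continuously on the point. -/
theorem eventually_mem_side {p : SplitReal} {U : Set ℝ} (hU : U ∈ side p) :
    ∀ᶠ q in 𝓝 p, U ∈ side q := by
  rcases p.left_or_right with hp | hp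
  · rw [hp, side_left] at hU
    obtain ⟨m, hm, hsub⟩ := mem_nhdsLT_iff_exists_Ioo_subset.1 hU
    have h1 : SplitReal.right m < p := SplitReal.lt_of_time_lt hm
    have h2 : p < SplitReal.right p.time := by nth_rw 1 [hp]; exact left_lt_right _
    filter_upwards [Ioi_mem_nhds h1, Iio_mem_nhds h2] with q hq1 hq2
    have hmq := SplitReal.time_lt_of_right_lt hq1
    rcases lt_or_ge q.time p.time with hlt | hge
    · exact side_le q (mem_of_superset (Ioo_mem_nhds hmq hlt) hsub)
    · have : q = SplitReal.left p.time := by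
        have hle := le_left_iff_lt_right.2 hq2
        refine hle.eq_of_not_lt fun h => ?_
        exact absurd (SplitReal.time_lt_of_lt_left h) (not_lt.2 hge)
      rwa [this, side_left]
  · rw [hp, side_right] at hU
    obtain ⟨m, hm, hsub⟩ := mem_nhdsGT_iff_exists_Ioo_subset.1 hU
    have h1 : p < SplitReal.left m := SplitReal.lt_of_time_lt hm
    have h2 : SplitReal.left p.time < p := by nth_rw 2 [hp]; exact left_lt_right _
    filter_upwards [Iio_mem_nhds h1, Ioi_mem_nhds h2] with q hq1 hq2
    have hmq := SplitReal.time_lt_of_lt_left hq1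
    rcases lt_or_ge p.time q.time with hlt | hge
    · exact side_le q (mem_of_superset (Ioo_mem_nhds hlt hmq) hsub)
    · have : q = SplitReal.right p.time := by
        have hle : SplitReal.right p.time ≤ q :=
          not_lt.1 fun h => absurd (le_left_iff_lt_right.2 h) (not_le.2 hq2)
        refine (hle.eq_of_not_lt fun h => ?_).symm
        exact absurd (SplitReal.time_lt_of_right_lt h) (not_lt.2 hge)
      rwa [this, side_right]

theorem continuous_of_tendsto_side (hD : Dense D) {F : SplitReal → EReal}
    (hF : ∀ p, Tendsto x (side p ⊓ 𝓟 D) (𝓝 (F p))) : Continuous F := by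
  refine continuous_iff_continuousAt.2 fun p => ?_
  refine (closed_nhds_basis (F p)).tendsto_right_iff.2 fun C hC => ?_
  have h1 := mem_inf_principal.1 (hF p hC.1)
  filter_upwards [eventually_mem_side h1] with q hq
  have := side_inf_neBot hD q
  exact hC.2.mem_of_tendsto (hF q) (mem_inf_principal.2 hq)

/-- Paths of `B` through `(c, w)` with `w ∈ D` and `w ↓ s` are eventually above `x` at time `w`,
because `f(s+) < c`. They stay above `x` on `D`, and so does their limit. -/
theorem Separating.dominatedBy (hB : IsWeave B) (hx : Separating B D x) (hD : Dense D)
    (hf : ∀ p, Tendsto x (side p ⊓ 𝓟 D) (𝓝 (f.toFun p))) : DominatedBy B f := by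
  intro s c hc
  have := side_inf_neBot hD (SplitReal.right s)
  obtain ⟨𝒰, h𝒰⟩ := Ultrafilter.exists_le (side (SplitReal.right s) ⊓ 𝓟 D)
  have hlt : ∀ᶠ w in (𝒰 : Filter ℝ), x w < c :=
    ((hf _).mono_left h𝒰).eventually (gt_mem_nhds (hi_lt_iff.1 hc).2)
  have hwD : ∀ᶠ w in (𝒰 : Filter ℝ), w ∈ D := h𝒰 (mem_inf_of_right (mem_principal_self D))
  have hws : Tendsto (fun w : ℝ => w) 𝒰 (𝓝 s) := (h𝒰.trans inf_le_left).trans (side_le _)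
  choose G hG hGon using fun w : ℝ => hB.covers c w
  obtain ⟨g, hg, hsub⟩ := hB.limClosed _ 𝒰 G (Eventually.of_forall hG)
  have hon := hsub.on (tendsto_const_nhds (x := c)) hws (Eventually.of_forall hGon)
  have hcmp : ∀ t ∈ D, s < t → x t ≤ g.hi t := by
    intro t ht hst
    obtain ⟨v, hv⟩ := exists_tendsto_ultrafilter 𝒰 fun w => (G w).hi t
    have hwt : ∀ᶠ w in (𝒰 : Filter ℝ), w < t := hws.eventually (gt_mem_nhds hst)
    have hvon := hsub.on hv tendsto_const_nhds (by
      filter_upwards [hwt] with w hw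
      exact on_hi (hB.subset_up (hG w)) ((hGon w).start_le.trans (EReal.coe_le_coe_iff.2 hw.le)))
    refine le_trans (ge_of_tendsto hv ?_) hvon.le_hi
    filter_upwards [hwt, hlt, hwD] with w h1 h2 h3
    exact (hx _ (hG w) w h3 t ht h1 c (hGon w)).2 h2
  refine ⟨g, hg, hon, fun p hp => ?_⟩
  have := side_inf_neBot hD p
  refine le_of_tendsto_of_tendsto (hf p) ((tendsto_hi_side (hB.subset_up hg)
    (hon.start_le.trans_lt (EReal.coe_lt_coe_iff.2 hp))).mono_left inf_le_left) ?_
  refine mem_inf_principal.2 ?_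
  filter_upwards [side_le p (lt_mem_nhds hp)] with t ht htD using hcmp t htD ht

/-- The path of the flow obtained from a separating function by taking one-sided limits. -/
theorem Separating.exists_mem_flow (hB : IsWeave B) (hx : Separating B D x) (hD : Dense D) :
    ∃ f ∈ flow B, ∀ p, Tendsto x (side p ⊓ 𝓟 D) (𝓝 (f.toFun p)) := by
  choose F hF using hx.exists_limit hB hD
  let f : Path :=
    { start := ⊥
      finish := ⊤
      start_le_finish := bot_le
      toFun := F
      continuousOn := (continuous_of_tendsto_side hD hF).continuousOn
      eq_zero_of_notMem := fun p hp => absurd ⟨bot_le, le_top⟩ hp }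
  refine ⟨f, hB.mem_flow ⟨rfl, rfl⟩ ⟨hx.dominatedBy hB hD hF, ?_⟩, hF⟩
  exact hx.neg.dominatedBy hB.negSet hD fun p => (hF p).neg

end

end Weaves

namespace Weaves
open Weaves.Path

variable {f g h y : Path} {A B : Set Path} {a b c d : EReal} {s t u : ℝ}

/-! ### Approximating the paths of a flow -/

theorem exists_ultrafilter_of_not_eventually {ι : Type*} {l : Filter ι} {P : ι → Prop}
    (h : ¬ ∀ᶠ i in l, P i) :
    ∃ 𝒱 : Ultrafilter ι, ↑𝒱 ≤ l ∧ ∀ᶠ i in (𝒱 : Filter ι), ¬ P i := by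
  have : (l ⊓ 𝓟 {i | ¬ P i}).NeBot := frequently_mem_iff_neBot.1 (not_eventually.1 h)
  obtain ⟨𝒱, h𝒱⟩ := Ultrafilter.exists_le (l ⊓ 𝓟 {i | ¬ P i})
  exact ⟨𝒱, h𝒱.trans inf_le_left, h𝒱 (mem_inf_of_right (mem_principal_self _))⟩

theorem flow_no_upcrossing (hy : y ∈ flow A) (hg : g ∈ A) (hpre : g.Pre c s b u)
    (hc : c < y.lo s) (hb : y.hi u < b) : False := by
  obtain ⟨g', -, egg, hle | hle⟩ := (hy.2 g hg).exists_extension hy.1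
  · exact absurd ((lo_mono hle s).trans (On.lo_le (egg.pre hpre).1)) (not_le.2 hc)
  · exact absurd ((On.le_hi (egg.pre hpre).2.1).trans (hi_mono hle u)) (not_le.2 hb)

theorem flow_no_downcrossing (hy : y ∈ flow A) (hg : g ∈ A) (hpre : g.Pre c s b u)
    (hc : y.hi s < c) (hb : b < y.lo u) : False := by
  obtain ⟨g', -, egg, hle | hle⟩ := (hy.2 g hg).exists_extension hy.1
  · exact absurd ((lo_mono hle u).trans (On.lo_le (egg.pre hpre).2.1)) (not_le.2 hb)
  · exact absurd ((On.le_hi (egg.pre hpre).1).trans (hi_mono hle s)) (not_le.2 hc)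

/-- A violation comes from a path of `B n` that passes from below `a` at time `s` to above `b` at
time `u`, or, if `u < s`, from above `b` to below `a`. The times stay in compact intervals, so a
sublimit in `A` would cross `y`. -/
theorem eventually_lowerFn_le {B : ℕ → Set Path} (hB : ∀ n, B n ⊆ upPaths)
    (hlim : ∀ 𝒱 : Ultrafilter ℕ, ↑𝒱 ≤ (atTop : Filter ℕ) → LimitsIn 𝒱 B A) (hy : y ∈ flow A)
    {s₁ s₂ u₁ u₂ : ℝ} (ha : ∀ t ∈ Icc s₁ s₂, a < y.lo t) (hb : ∀ t ∈ Icc u₁ u₂, y.hi t < b) :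
    ∀ᶠ n in atTop, ∀ s ∈ Icc s₁ s₂, ∀ u ∈ Icc u₁ u₂, lowerFn (B n) a s u ≤ b := by
  by_contra hcon
  obtain ⟨𝒱, h𝒱, hnot⟩ := exists_ultrafilter_of_not_eventually hcon
  have hbad : ∀ᶠ n in (𝒱 : Filter ℕ), ∃ s ∈ Icc s₁ s₂, ∃ u ∈ Icc u₁ u₂, b < lowerFn (B n) a s u := by
    filter_upwards [hnot] with n hn
    push Not at hn
    exact hn
  choose! s hs u hu hsu using fun (n : ℕ) (hn : ∃ s ∈ Icc s₁ s₂, ∃ u ∈ Icc u₁ u₂,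
    b < lowerFn (B n) a s u) => hn
  obtain ⟨s₀, hs₀, hsl⟩ := isCompact_Icc.ultrafilter_le_nhds (𝒱.map s)
    (le_principal_iff.2 (Filter.mem_map.2 (hbad.mono hs)))
  obtain ⟨u₀, hu₀, hul⟩ := isCompact_Icc.ultrafilter_le_nhds (𝒱.map u)
    (le_principal_iff.2 (Filter.mem_map.2 (hbad.mono hu)))
  replace hsl : Tendsto s 𝒱 (𝓝 s₀) := hsl
  replace hul : Tendsto u 𝒱 (𝓝 u₀) := hul
  have hlim := hlim 𝒱 h𝒱
  have : Nonempty Path := ⟨y⟩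
  have hcase : (∀ᶠ n in (𝒱 : Filter ℕ), s n < u n) ∨ (∀ᶠ n in (𝒱 : Filter ℕ), s n = u n) ∨
      (∀ᶠ n in (𝒱 : Filter ℕ), u n < s n) := by
    rw [← Ultrafilter.eventually_or, ← Ultrafilter.eventually_or]
    exact Eventually.of_forall fun n => lt_trichotomy _ _
  rcases hcase with hc | hc | hc
  · have hev : ∀ᶠ n in (𝒱 : Filter ℕ), ∃ g, ∃ c, g ∈ B n ∧ c < a ∧
        g.Pre c (s n) (g.lo (u n)) (u n) ∧ b < g.lo (u n) := by
      filter_upwards [hbad, hc] with n hn hlt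
      have h1 := hsu n hn
      rw [lowerFn_of_lt hlt] at h1
      obtain ⟨-, ⟨g, hg, c, hca, hon, rfl⟩, hbg⟩ := lt_sSup_iff.1 h1
      exact ⟨g, c, hg, hca, hon.pre_of_lt (on_lo (hB n hg)
        (hon.start_le.trans (EReal.coe_le_coe_iff.2 hlt.le))) hlt, hbg⟩
    choose! G c h1 h2 h3 h4 using fun (n : ℕ) (hn : ∃ g, ∃ c, g ∈ B n ∧ c < a ∧
        g.Pre c (s n) (g.lo (u n)) (u n) ∧ b < g.lo (u n)) => hn
    obtain ⟨g, hg, hsub⟩ := hlim G (hev.mono h1)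
    obtain ⟨c₀, hc₀⟩ := exists_tendsto_ultrafilter 𝒱 c
    obtain ⟨b₀, hb₀⟩ := exists_tendsto_ultrafilter 𝒱 fun n => (G n).lo (u n)
    refine flow_no_upcrossing hy hg (hsub _ _ _ _ _ _ _ _ hc₀ hsl hb₀ hul (hev.mono h3))
      ((le_of_tendsto hc₀ (hev.mono fun n hn => (h2 n hn).le)).trans_lt (ha s₀ hs₀))
      ((hb u₀ hu₀).trans_le (ge_of_tendsto hb₀ (hev.mono fun n hn => (h4 n hn).le)))
  · obtain ⟨n, hn, heq⟩ := (hbad.and hc).exists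
    have h1 := hsu n hn
    have hs' := hs n hn
    have hu' := hu n hn
    rw [heq] at h1 hs'
    rw [lowerFn_self] at h1
    exact absurd (((ha _ hs').trans_le (y.lo_le_hi _)).trans (hb _ hu')) h1.not_gt
  · have hev : ∀ᶠ n in (𝒱 : Filter ℕ), ∃ g, ∃ c, g ∈ B n ∧ b < c ∧
        g.Pre c (u n) (g.hi (s n)) (s n) ∧ g.hi (s n) < a := by
      filter_upwards [hbad, hc] with n hn hlt
      have h1 := hsu n hn
      rw [lowerFn_of_gt hlt] at h1
      obtain ⟨c, ⟨g, hg, hon, hga⟩, hbc⟩ := lt_sSup_iff.1 h1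
      exact ⟨g, c, hg, hbc, hon.pre_of_lt (on_hi (hB n hg)
        (hon.start_le.trans (EReal.coe_le_coe_iff.2 hlt.le))) hlt, hga⟩
    choose! G c h1 h2 h3 h4 using fun (n : ℕ) (hn : ∃ g, ∃ c, g ∈ B n ∧ b < c ∧
        g.Pre c (u n) (g.hi (s n)) (s n) ∧ g.hi (s n) < a) => hn
    obtain ⟨g, hg, hsub⟩ := hlim G (hev.mono h1)
    obtain ⟨c₀, hc₀⟩ := exists_tendsto_ultrafilter 𝒱 c
    obtain ⟨a₀, ha₀⟩ := exists_tendsto_ultrafilter 𝒱 fun n => (G n).hi (s n)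
    exact flow_no_downcrossing hy hg (hsub _ _ _ _ _ _ _ _ hc₀ hul ha₀ hsl (hev.mono h3))
      ((hb u₀ hu₀).trans_le (ge_of_tendsto hc₀ (hev.mono fun n hn => (h2 n hn).le)))
      ((le_of_tendsto ha₀ (hev.mono fun n hn => (h4 n hn).le)).trans_lt (ha s₀ hs₀))

/-- The level `q.1` is a lower bound for `y` during the time interval `[q.2.1, q.2.2]`. -/
def IsLower (y : Path) (q : EReal × ℝ × ℝ) : Prop := ∀ t ∈ Icc q.2.1 q.2.2, q.1 < y.lo t

/-- The level `q.1` is an upper bound for `y` during the time interval `[q.2.1, q.2.2]`. -/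
def IsUpper (y : Path) (q : EReal × ℝ × ℝ) : Prop := ∀ t ∈ Icc q.2.1 q.2.2, y.hi t < q.1

/-- The path `f` satisfies those bounds from the set `S` that are satisfied by `y`. -/
def Respects (S : Finset (EReal × ℝ × ℝ)) (y f : Path) : Prop :=
  (∀ q ∈ S, IsLower y q → ∀ t ∈ Ioo q.2.1 q.2.2, q.1 ≤ f.lo t) ∧
    ∀ q ∈ S, IsUpper y q → ∀ t ∈ Ioo q.2.1 q.2.2, f.hi t ≤ q.1

theorem IsWeave.exists_respects (hB : IsWeave B) {D : Set ℝ} (hD : Dense D)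
    (hord : ∀ r ∈ D, OrderedAt B r) (S : Finset (EReal × ℝ × ℝ))
    (hS : ∀ q ∈ S, IsLower y q → ∀ q' ∈ S, IsUpper y q' →
      ∀ s ∈ Icc q.2.1 q.2.2, ∀ u ∈ Icc q'.2.1 q'.2.2, lowerFn B q.1 s u ≤ q'.1) :
    ∃ f ∈ flow B, Respects S y f := by
  -- Including the level of every lower bound at all its times in `D` makes the lower bounds
  -- automatic; the upper bounds are what `hS` provides. Only open intervals are controlled, as
  -- one-sided limits at an endpoint may use times outside.
  set x : ℝ → EReal := fun t => ⨆ k : {k : (EReal × ℝ × ℝ) × ℝ // k.1 ∈ S ∧ IsLower y k.1 ∧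
    k.2 ∈ Icc k.1.2.1 k.1.2.2 ∧ k.2 ∈ D}, lowerFn B k.1.1.1 k.1.2 t with hx
  have hsep : Separating B D x :=
    Separating.iSup fun k => separating_lowerFn hB.subset_up hord k.2.2.2.2
  obtain ⟨f, hf, hlim⟩ := hsep.exists_mem_flow hB hD
  have hside : ∀ (p : SplitReal) (r₁ r₂ : ℝ), p.time ∈ Ioo r₁ r₂ →
      ∀ᶠ t in side p ⊓ 𝓟 D, t ∈ Icc r₁ r₂ ∧ t ∈ D := fun p r₁ r₂ hp => by
    refine mem_inf_principal.2 ?_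
    filter_upwards [side_le p (Ioo_mem_nhds hp.1 hp.2)] with t ht htD
      using ⟨⟨ht.1.le, ht.2.le⟩, htD⟩
  have hlow : ∀ q ∈ S, IsLower y q → ∀ p : SplitReal, p.time ∈ Ioo q.2.1 q.2.2 →
      q.1 ≤ f.toFun p := fun q hq hql p hp => by
    have := side_inf_neBot hD p
    refine ge_of_tendsto (hlim p) ((hside p _ _ hp).mono fun t ht => ?_)
    have h1 := le_iSup (fun k : {k : (EReal × ℝ × ℝ) × ℝ // k.1 ∈ S ∧ IsLower y k.1 ∧
      k.2 ∈ Icc k.1.2.1 k.1.2.2 ∧ k.2 ∈ D} => lowerFn B k.1.1.1 k.1.2 t) ⟨(q, t), hq, hql, ht⟩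
    rwa [lowerFn_self] at h1
  have hupp : ∀ q ∈ S, IsUpper y q → ∀ p : SplitReal, p.time ∈ Ioo q.2.1 q.2.2 →
      f.toFun p ≤ q.1 := fun q hq hqu p hp => by
    have := side_inf_neBot hD p
    refine le_of_tendsto (hlim p) ((hside p _ _ hp).mono fun t ht => iSup_le fun k => ?_)
    exact hS k.1.1 k.2.1 k.2.2.1 q hq hqu _ k.2.2.2.1 t ht.1
  exact ⟨f, hf, fun q hq hql t ht => le_min (hlow q hq hql (.left t) ht) (hlow q hq hql (.right t) ht),
    fun q hq hqu t ht => max_le (hupp q hq hqu (.left t) ht) (hupp q hq hqu (.right t) ht)⟩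

theorem eq_of_toFun_eq (hf : f ∈ biPaths) (hg : g ∈ biPaths) (h : ∀ p, f.toFun p = g.toFun p) :
    f = g := by
  obtain ⟨h1, h2⟩ := hf
  obtain ⟨h3, h4⟩ := hg
  have h5 : f.toFun = g.toFun := funext h
  cases f
  cases g
  simp_all

theorem exists_Icc_subset_of_mem_side {p : SplitReal} {U : Set ℝ} (hU : U ∈ side p) :
    ∃ s₁ s₂ : ℝ, s₁ < s₂ ∧ Icc s₁ s₂ ⊆ U := by
  obtain ⟨r₁, r₂, hlt, hsub⟩ : ∃ r₁ r₂ : ℝ, r₁ < r₂ ∧ Ioo r₁ r₂ ⊆ U := by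
    rcases side_cases p with hp | hp <;> rw [hp] at hU
    · obtain ⟨m, hm, hsub⟩ := mem_nhdsLT_iff_exists_Ioo_subset.1 hU
      exact ⟨m, _, hm, hsub⟩
    · obtain ⟨m, hm, hsub⟩ := mem_nhdsGT_iff_exists_Ioo_subset.1 hU
      exact ⟨_, m, hm, hsub⟩
  obtain ⟨s₁, h1, h1'⟩ := exists_between hlt
  obtain ⟨s₂, h2, h2'⟩ := exists_between h1'
  exact ⟨s₁, s₂, h2, fun t ht => hsub ⟨h1.trans_le ht.1, ht.2.trans_lt h2'⟩⟩

/-- If `f` and `y` differed at a point of the split line, some level would strictly separate them on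
a whole time interval. This level and interval form a bound that eventually belongs to `S i`, and in
the limit `f` would have to obey it. -/
theorem eq_of_respects {ι : Type} {𝒱 : Ultrafilter ι} {F : ι → Path}
    {S : ι → Finset (EReal × ℝ × ℝ)} (hy : y ∈ biPaths) (hf : f ∈ biPaths) (hsub : SubLimit 𝒱 F f)
    (hF : ∀ᶠ i in 𝒱, F i ∈ biPaths ∧ Respects (S i) y (F i)) (hS : ∀ q, ∀ᶠ i in 𝒱, q ∈ S i) :
    f = y := by
  refine eq_of_toFun_eq hf hy fun p => ?_
  by_contra hne
  have hfp := start_lt_of_bi hf p.time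
  have hyp := start_lt_of_bi hy p.time
  rcases lt_or_gt_of_ne hne with hlt | hlt
  · obtain ⟨a, h1, h2⟩ := exists_between hlt
    obtain ⟨s₁, s₂, h12, hI⟩ := exists_Icc_subset_of_mem_side
      (((tendsto_hi_side hf.2 hfp).eventually (gt_mem_nhds h1)).and
        ((tendsto_lo_side hy.2 hyp).eventually (lt_mem_nhds h2)))
    obtain ⟨t, ht1, ht2⟩ := exists_between h12
    obtain ⟨v, hv⟩ := exists_tendsto_ultrafilter 𝒱 fun i => (F i).lo t
    have hon := hsub.on hv tendsto_const_nhds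
      (hF.mono fun i hi => on_lo hi.1.2 (start_le_of_bi hi.1 t))
    have hav : a ≤ v := ge_of_tendsto hv (by
      filter_upwards [hF, hS (a, s₁, s₂)] with i hi hSi
      exact hi.2.1 _ hSi (fun r hr => (hI hr).2) t ⟨ht1, ht2⟩)
    exact absurd (hav.trans hon.le_hi) (not_le.2 (hI ⟨ht1.le, ht2.le⟩).1)
  · obtain ⟨a, h1, h2⟩ := exists_between hlt
    obtain ⟨s₁, s₂, h12, hI⟩ := exists_Icc_subset_of_mem_side
      (((tendsto_lo_side hf.2 hfp).eventually (lt_mem_nhds h2)).and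
        ((tendsto_hi_side hy.2 hyp).eventually (gt_mem_nhds h1)))
    obtain ⟨t, ht1, ht2⟩ := exists_between h12
    obtain ⟨v, hv⟩ := exists_tendsto_ultrafilter 𝒱 fun i => (F i).hi t
    have hon := hsub.on hv tendsto_const_nhds
      (hF.mono fun i hi => on_hi hi.1.2 (start_le_of_bi hi.1 t))
    have hav : v ≤ a := le_of_tendsto hv (by
      filter_upwards [hF, hS (a, s₁, s₂)] with i hi hSi
      exact hi.2.2 _ hSi (fun r hr => (hI hr).2) t ⟨ht1, ht2⟩)
    exact absurd (hon.lo_le.trans hav) (not_le.2 (hI ⟨ht1.le, ht2.le⟩).1)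

theorem eventually_exists_dist_lt {B : ℕ → Set Path} (hB : ∀ n, IsWeave (B n)) (hA : IsWeave A)
    (hlim : ∀ (ι : Type) (𝒱 : Ultrafilter ι) (φ : ι → ℕ), Tendsto φ 𝒱 atTop →
      LimitsIn 𝒱 (fun i => B (φ i)) A) (hy : y ∈ flow A) {ε : ℝ} (hε : 0 < ε) :
    ∀ᶠ n in atTop, ∃ f ∈ flow (B n), dist f y < ε := by
  -- A single set of times serves all `n`: its complement is a countable union of countable sets.
  set D : Set ℝ := (⋃ n, {s | ¬ OrderedAt (B n) s})ᶜ with hDdef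
  have hD : Dense D := (countable_iUnion fun n =>
    countable_not_orderedAt (hB n).subset_up (hB n).nonCrossing).dense_compl ℝ
  have hord : ∀ n, ∀ r ∈ D, OrderedAt (B n) r := fun n r hr => by
    by_contra hcon
    exact hr (mem_iUnion.2 ⟨n, hcon⟩)
  have hex : ∀ S : Finset (EReal × ℝ × ℝ), ∀ᶠ n in atTop, ∃ f ∈ flow (B n), Respects S y f := by
    intro S
    have : ∀ᶠ n in atTop, ∀ q ∈ S, ∀ q' ∈ S, IsLower y q → IsUpper y q' →
        ∀ s ∈ Icc q.2.1 q.2.2, ∀ u ∈ Icc q'.2.1 q'.2.2, lowerFn (B n) q.1 s u ≤ q'.1 := by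
      rw [Finset.eventually_all]
      intro q hq
      rw [Finset.eventually_all]
      intro q' hq'
      by_cases h1 : IsLower y q
      · by_cases h2 : IsUpper y q'
        · filter_upwards [eventually_lowerFn_le (fun n => (hB n).subset_up)
            (fun 𝒱 h𝒱 => hlim _ 𝒱 id h𝒱) hy h1 h2] with n hn _ _ using hn
        · exact Eventually.of_forall fun n _ h => absurd h h2
      · exact Eventually.of_forall fun n h => absurd h h1
    filter_upwards [this] with n hn
    exact (hB n).exists_respects hD (hord n) S fun q hq hql q' hq' hqu => hn q hq q' hq' hql hqu
  by_contra hcon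
  rw [not_eventually] at hcon
  set l : Filter ℕ := atTop ⊓ 𝓟 {n | ¬ ∃ f ∈ flow (B n), dist f y < ε} with hl
  have hlne : l.NeBot := frequently_mem_iff_neBot.1 hcon
  -- Under the iterated filter `n` tends to infinity for fixed bounds before the set of bounds
  -- grows. This is a diagonal argument that needs no countable family of bounds.
  have hCne : (Filter.curry (atTop : Filter (Finset (EReal × ℝ × ℝ))) l).NeBot := by
    refine ⟨fun h => ?_⟩
    have : ∀ᶠ w in Filter.curry (atTop : Filter (Finset (EReal × ℝ × ℝ))) l, False := by
      rw [h]
      exact eventually_bot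
    rw [eventually_curry_iff] at this
    obtain ⟨S, hS⟩ := this.exists
    exact hS.exists.elim fun _ => id
  obtain ⟨𝒱, h𝒱⟩ := Ultrafilter.exists_le (Filter.curry (atTop : Filter (Finset (EReal × ℝ × ℝ))) l)
  have hev : ∀ {P : Finset (EReal × ℝ × ℝ) → ℕ → Prop}, (∀ᶠ S in atTop, ∀ᶠ n in l, P S n) →
      ∀ᶠ w in (𝒱 : Filter (Finset (EReal × ℝ × ℝ) × ℕ)), P w.1 w.2 := fun {P} h =>
    h𝒱 (show ∀ᶠ w in Filter.curry _ l, P w.1 w.2 from eventually_curry_iff.2 h)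
  have hgood : ∀ᶠ w in (𝒱 : Filter (Finset (EReal × ℝ × ℝ) × ℕ)), ∃ f ∈ flow (B w.2), Respects w.1 y f :=
    hev (Eventually.of_forall fun S => (hex S).filter_mono inf_le_left)
  have hbad : ∀ᶠ w in (𝒱 : Filter (Finset (EReal × ℝ × ℝ) × ℕ)),
      ¬ ∃ f ∈ flow (B w.2), dist f y < ε :=
    hev (P := fun _ n => ¬ ∃ f ∈ flow (B n), dist f y < ε)
      (Eventually.of_forall fun S => mem_inf_of_right (mem_principal_self _))
  have hsnd : Tendsto (fun w : Finset (EReal × ℝ × ℝ) × ℕ => w.2) 𝒱 atTop := fun U hU =>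
    hev (P := fun _ n => n ∈ U) (Eventually.of_forall fun S => mem_inf_of_left hU)
  have hmem : ∀ q, ∀ᶠ w in (𝒱 : Filter (Finset (EReal × ℝ × ℝ) × ℕ)), q ∈ w.1 := fun q =>
    hev (P := fun S _ => q ∈ S) (by
      filter_upwards [eventually_ge_atTop {q}] with S hS
      exact Eventually.of_forall fun n => hS (Finset.mem_singleton_self q))
  have : Nonempty Path := ⟨y⟩
  choose! F hF hFr using fun (w : Finset (EReal × ℝ × ℝ) × ℕ)
    (hw : ∃ f ∈ flow (B w.2), Respects w.1 y f) => hw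
  obtain ⟨f, hf, hflim, -⟩ := exists_limit_flanked (𝒱 := 𝒱) (B := fun w => B w.2) (F := F)
    hA.subset_up hA.nonCrossing
    (Eventually.of_forall fun w => ⟨(hB w.2).subset_up, (hB w.2).limClosed⟩) (hlim _ 𝒱 _ hsnd)
    (hgood.mono fun w hw => ⟨(hF w hw).1, (hB w.2).flanked (hF w hw)⟩)
  obtain rfl := eq_of_respects hy.1 hf (subLimit_of_tendsto hflim)
    (hgood.mono fun w hw => ⟨(hF w hw).1, hFr w hw⟩) hmem
  obtain ⟨w, h1, h2, h3⟩ := (hgood.and (hbad.and (hflim.eventually (Metric.ball_mem_nhds f hε)))).exists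
  exact h2 ⟨F w, hF w h1, h3⟩

/-! ### Continuity of the flow map -/

theorem isWeave_of_mem_detWeaves {A : CompactsIn upPaths} (hA : A ∈ detWeaves) :
    IsWeave (A.1 : Set Path) where
  subset_up := A.2
  nonCrossing := hA.1
  limClosed := limClosed_compacts A.1
  covers x t := hA.2 (SpaceTime.point x t)

/-- A path of the weave through `(∗, -∞)` is bi-infinite. -/
theorem nonempty_flow {A : CompactsIn upPaths} (hA : A ∈ detWeaves) :
    (flow (A.1 : Set Path)).Nonempty := by
  obtain ⟨f, hf, hbot⟩ := hA.2 SpaceTime.atBot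
  exact ⟨f, ⟨hbot, A.2 hf⟩, fun g hg => hA.1 f hf g hg⟩

/-- The flow of a deterministic weave, as a nonempty compact set of bi-infinite paths. -/
def flowMap (A : detWeaves) : CompactsIn biPaths :=
  ⟨⟨⟨flow (A.1.1 : Set Path), (isWeave_of_mem_detWeaves A.2).isCompact_flow⟩, nonempty_flow A.2⟩,
    fun _ hf => hf.1⟩

theorem coe_flowMap (A : detWeaves) : ((flowMap A).1 : Set Path) = flow (A.1.1 : Set Path) := rfl

theorem continuous_flowMap : Continuous flowMap := by
  refine continuous_iff_seqContinuous.2 fun A A₀ hA => ?_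
  have hw : ∀ n, IsWeave ((A n).1.1 : Set Path) := fun n => isWeave_of_mem_detWeaves (A n).2
  have hw₀ : IsWeave (A₀.1.1 : Set Path) := isWeave_of_mem_detWeaves A₀.2
  have hA' : Tendsto (fun n => (A n).1.1) atTop (𝓝 A₀.1.1) :=
    tendsto_subtype_rng.1 (tendsto_subtype_rng.1 hA)
  have hlim : ∀ (ι : Type) (𝒱 : Ultrafilter ι) (φ : ι → ℕ), Tendsto φ 𝒱 atTop →
      LimitsIn 𝒱 (fun i => ((A (φ i)).1.1 : Set Path)) (A₀.1.1 : Set Path) :=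
    fun ι 𝒱 φ hφ => limitsIn_of_tendsto (hA'.comp hφ)
  refine tendsto_subtype_rng.2 (Metric.tendsto_nhds.2 fun ε hε => ?_)
  have hε2 : 0 < ε / 2 := by positivity
  have hε4 : 0 < ε / 2 / 2 := by positivity
  have : Nonempty Path := let ⟨f, _⟩ := nonempty_flow A₀.2; ⟨f⟩
  -- Otherwise paths of the flows far from the limiting flow would have a flanked limit, which
  -- belongs to that flow.
  have hup : ∀ᶠ n in atTop, ∀ f ∈ flow ((A n).1.1 : Set Path),
      ∃ y ∈ flow (A₀.1.1 : Set Path), dist f y ≤ ε / 2 := by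
    by_contra hcon
    obtain ⟨𝒱, h𝒱, hnot⟩ := exists_ultrafilter_of_not_eventually hcon
    have hbad : ∀ᶠ n in (𝒱 : Filter ℕ), ∃ f ∈ flow ((A n).1.1 : Set Path),
        ∀ y ∈ flow (A₀.1.1 : Set Path), ε / 2 < dist f y := by
      filter_upwards [hnot] with n hn
      push Not at hn
      exact hn
    choose! F hF hFd using fun (n : ℕ) (hn : ∃ f ∈ flow ((A n).1.1 : Set Path),
        ∀ y ∈ flow (A₀.1.1 : Set Path), ε / 2 < dist f y) => hn
    obtain ⟨f, hf, hflim, hfl⟩ := exists_limit_flanked (𝒱 := 𝒱) (F := F)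
      hw₀.subset_up hw₀.nonCrossing
      (Eventually.of_forall fun n => ⟨(hw n).subset_up, (hw n).limClosed⟩)
      (hlim _ 𝒱 id h𝒱)
      (hbad.mono fun n hn => ⟨(hF n hn).1, (hw n).flanked (hF n hn)⟩)
    obtain ⟨n, hn, hd⟩ := (hbad.and (hflim.eventually (Metric.ball_mem_nhds f hε2))).exists
    exact absurd (hFd n hn f (hw₀.mem_flow hf hfl)) (not_lt.2 (le_of_lt hd))
  -- Compactness of the limiting flow makes the approximation of its single paths uniform.
  have hlow : ∀ᶠ n in atTop, ∀ y ∈ flow (A₀.1.1 : Set Path),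
      ∃ f ∈ flow ((A n).1.1 : Set Path), dist y f ≤ ε / 2 := by
    by_contra hcon
    obtain ⟨𝒱, h𝒱, hnot⟩ := exists_ultrafilter_of_not_eventually hcon
    have hbad : ∀ᶠ n in (𝒱 : Filter ℕ), ∃ y ∈ flow (A₀.1.1 : Set Path),
        ∀ f ∈ flow ((A n).1.1 : Set Path), ε / 2 < dist y f := by
      filter_upwards [hnot] with n hn
      push Not at hn
      exact hn
    choose! Y hY hYd using fun (n : ℕ) (hn : ∃ y ∈ flow (A₀.1.1 : Set Path),
        ∀ f ∈ flow ((A n).1.1 : Set Path), ε / 2 < dist y f) => hn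
    obtain ⟨y, hy, hylim⟩ := hw₀.isCompact_flow.ultrafilter_le_nhds (𝒱.map Y)
      (le_principal_iff.2 (Filter.mem_map.2 (hbad.mono hY)))
    replace hylim : Tendsto Y 𝒱 (𝓝 y) := hylim
    have hev := (eventually_exists_dist_lt hw hw₀ hlim hy hε4).filter_mono h𝒱
    obtain ⟨n, hn, hd, f, hf, hfy⟩ :=
      (hbad.and ((hylim.eventually (Metric.ball_mem_nhds y hε4)).and hev)).exists
    have hd' : dist (Y n) y < ε / 2 / 2 := hd
    have h1 := hYd n hn f hf
    have h2 := dist_triangle_right (Y n) f y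
    linarith
  filter_upwards [hup, hlow] with n h1 h2
  rw [Metric.NonemptyCompacts.dist_eq]
  exact (Metric.hausdorffDist_le_of_mem_dist hε2.le h1 h2).trans_lt (half_lt_self hε)

/-! ### Limit points of families of weaves -/

/-- Paths through `z` chosen in the approximating weaves converge to a path of `B`. It passes
through `z` because the diagonal point `(z, z)` stays in the limit of the second order graphs. -/
theorem isPervasive_of_mem_closure {𝒜 : Set (CompactsIn upPaths)} (h𝒜 : 𝒜 ⊆ detWeaves)
    {B : CompactsIn upPaths} (hB : B ∈ closure 𝒜) : IsPervasive (B.1 : Set Path) := by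
  intro z
  obtain ⟨𝒱, hmem, hlim⟩ := mem_closure_iff_ultrafilter.1 hB
  have hex : ∀ K ∈ 𝒜, ∃ f ∈ (K.1 : Set Path), z ∈ f.graph := fun K hK => (h𝒜 hK).2 z
  have : Nonempty Path := let ⟨f, _⟩ := B.1.nonempty; ⟨f⟩
  choose! F hF hz using hex
  have hlim' : Tendsto (fun K : CompactsIn upPaths => K.1) 𝒱 (𝓝 B.1) :=
    (continuous_subtype_val.tendsto B).mono_left hlim
  obtain ⟨f, hf, hflim⟩ := exists_limit_mem_compacts hlim' (z := F)
    (mem_of_superset hmem fun K hK => hF K hK)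
  have := mem_of_tendsto_compacts ((isometry_compactGraph₂.continuous.tendsto f).comp hflim)
    (z := fun _ => (z, z)) tendsto_const_nhds
    (mem_of_superset hmem fun K hK => refl_mem_graph₂ (hz K hK))
  exact ⟨f, hf, this.1⟩

end Weaves

end

theorem lemma4 :
    -- the flow map sends deterministic weaves to nonempty compact sets of bi-infinite paths,
    -- continuously
    (∃ Φ : Weaves.detWeaves → Weaves.CompactsIn Weaves.biPaths,
      (∀ A : Weaves.detWeaves,
        ((Φ A).1 : Set Weaves.Path) = Weaves.flow (A.1.1 : Set Weaves.Path)) ∧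
      Continuous Φ) ∧
    -- relative compactness is preserved if all limit points are non-crossing
    (∀ 𝒜 : Set (Weaves.CompactsIn Weaves.upPaths), 𝒜 ⊆ Weaves.detWeaves →
      IsCompact (closure 𝒜) →
      (∀ B : Weaves.CompactsIn Weaves.upPaths, AccPt B (𝓟 𝒜) →
        Weaves.IsNonCrossing (B.1 : Set Weaves.Path)) →
      IsCompact (closure {F : Weaves.CompactsIn Weaves.biPaths |
        ∃ A ∈ 𝒜, (F.1 : Set Weaves.Path) = Weaves.flow (A.1 : Set Weaves.Path)})) := by
  refine ⟨⟨Weaves.flowMap, Weaves.coe_flowMap, Weaves.continuous_flowMap⟩, ?_⟩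
  intro 𝒜 h𝒜 hcomp hacc
  -- Only non-crossing can be lost in the limit, and the assumption on limit points restores it.
  have hsub : closure 𝒜 ⊆ Weaves.detWeaves := by
    intro B hB
    refine ⟨?_, Weaves.isPervasive_of_mem_closure h𝒜 hB⟩
    rw [closure_eq_self_union_derivedSet] at hB
    rcases hB with hB | hB
    · exact (h𝒜 hB).1
    · exact hacc B hB
  have hC : IsCompact ((Subtype.val : Weaves.detWeaves → _) ⁻¹' closure 𝒜) := by
    rw [Subtype.isCompact_iff, Subtype.image_preimage_coe, inter_eq_right.2 hsub]
    exact hcomp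
  refine (hC.image Weaves.continuous_flowMap).closure_of_subset ?_
  rintro F ⟨A, hA, hF⟩
  refine ⟨⟨A, h𝒜 hA⟩, subset_closure hA, ?_⟩
  exact Subtype.ext (SetLike.coe_injective hF.symm)
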